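/- **Setting.** Let $(\mathcal X,\Sigma)$ be a measurable space and let $Q,P$ be probability measures on it with $Q\ll P$. A *partitioning process* is a random process $Z:\mathbb N^+\to\Sigma$ with $Z_1=\mathcal X$, $Z_{2n}\cap Z_{2n+1}=\emptyset$ and $Z_{2n}\cup Z_{2n+1}=Z_n$. *Greedy Rejection Coding* (GRC) with target $Q$, proposal $P$ and partitioning process $Z$ is the following procedure. Set $I_0=1$, $S_0=Z_1=\mathcal X$ and $T_0=0$ (the zero measure). For $d=0,1,2,\dots$, with $t_d=dT_d/dP$, put $$\alpha_{d+1}(x)=\min\Big\{\tfrac{dQ}{dP}(x)-t_d(x),\ \tfrac{1-T_d(\mathcal X)}{P(S_d)}\Big\},\quad A_{d+1}(S)=\int_S\alpha_{d+1}\,dP,\quad \beta_{d+1}(x)=\alpha_{d+1}(x)\,\tfrac{P(S_d)}{1-T_d(\mathcal X)}.$$ Given the past, draw independently $X_d\sim P|_{S_d}/P(S_d)$ and $U_d\sim\mathrm{Uniform}(0,1)$. If $U_d\le\beta_{d+1}(X_d)$, terminate and return $X_d$. Otherwise, given the past, draw $$b_d\sim\mathrm{Bernoulli}\Big(\tfrac{Q(Z_{2I_d+1})-T_d(Z_{2I_d+1})-A_{d+1}(Z_{2I_d+1})}{Q(S_d)-T_d(S_d)-A_{d+1}(S_d)}\Big),$$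 and set $I_{d+1}=2I_d+b_d$, $S_{d+1}=Z_{I_{d+1}}$ and $T_{d+1}(S)=T_d(S\cap S_{d+1})+A_{d+1}(S\cap S_{d+1})+Q(S\setminus S_{d+1})$. The process $Z$ may be deterministic, random and independent of the draws, or split the active set depending on the draws made so far: it is only required that the two children of the current node are determined before the coin $b_d$ is tossed. For $d\ge 0$ and $S\in\Sigma$ let $\tau_d(S)$ be the probability that GRC terminates within $d$ steps and returns a sample in $S$. **Theorem 1 (Correctness of GRC).** Suppose that at least one of the following holds. 1. (*Finite ratio mode*) There is $M\in\mathbb R$ with $\frac{dQ}{dP}<M$ ($P$-almost everywhere). 2. (*Single branch*) For each $d$, almost surely, if step $d$ ends in a rejection, then the outcome of the coin $b_d$ is determined by the past, i.e. its success probability is $0$ or $1$. 3. (*Nicely shrinking $Z$*) $\mathcal X\subseteq\mathbb R^N$ with its Borel $\sigma$-algebra and, almost surely, for each $x\in\mathcal X$ and each sequence of nodes $k_0=1$, $k_{d+1}\in\{2k_d,2k_d+1\}$ with $x\in Z_{k_d}$ for all $d$ and $P(Z_{k_d})\to0$, there are $\gamma>0$ and $r_d>0$ with $r_d\to0$ such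 that, for all sufficiently large $d$, $Z_{k_d}\subseteq B_{r_d}(x)$ and $P(Z_{k_d})\ge\gamma\,P(B_{r_d}(x))$, where $B_r(x)$ is the open Euclidean ball. Then GRC terminates with probability $1$ and its returned sample $X$ has law $Q$. Moreover $\tau_d\to Q$ in total variation, i.e. $\sup_{S\in\Sigma}|Q(S)-\tau_d(S)|\to0$ as $d\to\infty$. -/

import Mathlib

open MeasureTheory ProbabilityTheory Filter Topology
open scoped ENNReal

namespace GRC

noncomputable section

/-! ## Partitioning processes on the infinite binary tree -/

/-- One realisation of a partitioning process: `Z n` is the measurable set attached to the node with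
heap index `n ≥ 1`; the value `Z 0` is unused. -/
structure IsPartitioning {𝓧 : Type*} [MeasurableSpace 𝓧] (Z : ℕ → Set 𝓧) : Prop where
  measurableSet : ∀ n, 1 ≤ n → MeasurableSet (Z n)
  root : Z 1 = Set.univ
  disjoint : ∀ n, 1 ≤ n → Z (2 * n) ∩ Z (2 * n + 1) = ∅
  union : ∀ n, 1 ≤ n → Z (2 * n) ∪ Z (2 * n + 1) = Z n

/-! ## The recursion along a sequence of active sets `S 0, S 1, …` -/

section Recursion

variable {𝓧 : Type*} [MeasurableSpace 𝓧]

/-- `min {dQ/dP - t, (1 - T(𝓧)) / P(s)}`, for a ruled out measure `T` with density `t` and an active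
set `s`. -/
def greedyDensity (Q P T : Measure 𝓧) (t : 𝓧 → ℝ≥0∞) (s : Set 𝓧) (x : 𝓧) : ℝ≥0∞ :=
  min (Q.rnDeriv P x - t x) ((1 - T Set.univ) / P s)

open Classical in
/-- The ruled out measure `T_d` together with its density `t_d` with respect to `P`. The density is
carried along the recursion, so that one version of it is fixed: it is `t_d + α_{d+1}` on the new
active set and `dQ/dP` off it. -/
def ruledOut (Q P : Measure 𝓧) (S : ℕ → Set 𝓧) : ℕ → Measure 𝓧 × (𝓧 → ℝ≥0∞)
  | 0 => (0, fun _ => 0)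
  | d + 1 =>
    let T := (ruledOut Q P S d).1
    let t := (ruledOut Q P S d).2
    let a := greedyDensity Q P T t (S d)
    (T.restrict (S (d + 1)) + (P.withDensity a).restrict (S (d + 1)) + Q.restrict (S (d + 1))ᶜ,
      fun x => if x ∈ S (d + 1) then t x + a x else Q.rnDeriv P x)

/-- The ruled out measure `T_d(·, S_{0:d})`. -/
def T (Q P : Measure 𝓧) (S : ℕ → Set 𝓧) (d : ℕ) : Measure 𝓧 := (ruledOut Q P S d).1

/-- The density `t_d(·, S_{0:d}) = dT_d/dP`; see `t_ae_eq_rnDeriv`. -/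
def t (Q P : Measure 𝓧) (S : ℕ → Set 𝓧) (d : ℕ) : 𝓧 → ℝ≥0∞ := (ruledOut Q P S d).2

/-- The density `α_{d+1}(·, S_{0:d})`; the index `d` here is the number of completed steps. -/
def α (Q P : Measure 𝓧) (S : ℕ → Set 𝓧) (d : ℕ) : 𝓧 → ℝ≥0∞ :=
  greedyDensity Q P (T Q P S d) (t Q P S d) (S d)

/-- The measure `A_{d+1}(·, S_{0:d})` with density `α_{d+1}` with respect to `P`. -/
def A (Q P : Measure 𝓧) (S : ℕ → Set 𝓧) (d : ℕ) : Measure 𝓧 := P.withDensity (α Q P S d)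

/-- The acceptance probability `β_{d+1}(·, S_{0:d})`. -/
def β (Q P : Measure 𝓧) (S : ℕ → Set 𝓧) (d : ℕ) (x : 𝓧) : ℝ≥0∞ :=
  α Q P S d x * (P (S d) / (1 - T Q P S d Set.univ))

/-- The probability of moving to the child `s` of the active set `S d` after a rejection: the share
that `s` has of the mass of `Q` on `S d` that is not yet accounted for. -/
def branchProb (Q P : Measure 𝓧) (S : ℕ → Set 𝓧) (d : ℕ) (s : Set 𝓧) : ℝ≥0∞ :=
  (Q s - T Q P S d s - A Q P S d s) / (Q (S d) - T Q P S d (S d) - A Q P S d (S d))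

theorem T_zero (Q P : Measure 𝓧) (S : ℕ → Set 𝓧) : T Q P S 0 = 0 := rfl

theorem T_succ (Q P : Measure 𝓧) (S : ℕ → Set 𝓧) (d : ℕ) :
    T Q P S (d + 1) = (T Q P S d).restrict (S (d + 1)) + (A Q P S d).restrict (S (d + 1))
      + Q.restrict (S (d + 1))ᶜ := rfl

theorem measurable_t (Q P : Measure 𝓧) (S : ℕ → Set 𝓧) (hS : ∀ d, MeasurableSet (S d)) (d : ℕ) :
    Measurable (t Q P S d) := by
  induction d with
  | zero => exact measurable_const
  | succ d ih =>
    have ha : Measurable (α Q P S d) :=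
      (((Q.measurable_rnDeriv P).sub ih).min measurable_const)
    exact Measurable.ite (hS (d + 1)) (ih.add ha) (Q.measurable_rnDeriv P)

/-- `t_d` is a density of `T_d` with respect to `P`. -/
theorem T_eq_withDensity (Q P : Measure 𝓧) [IsProbabilityMeasure Q] [IsProbabilityMeasure P]
    (hQP : Q ≪ P) (S : ℕ → Set 𝓧) (hS : ∀ d, MeasurableSet (S d)) (d : ℕ) :
    T Q P S d = P.withDensity (t Q P S d) := by
  classical
  induction d with
  | zero => exact withDensity_zero.symm
  | succ d ih =>
    have hm := measurable_t Q P S hS d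
    have ht : t Q P S (d + 1) = (S (d + 1)).indicator (t Q P S d + α Q P S d)
        + (S (d + 1))ᶜ.indicator (Q.rnDeriv P) := by
      funext x
      by_cases hx : x ∈ S (d + 1) <;> simp [t, ruledOut, α, T, hx]
    have hr : Measurable ((S (d + 1))ᶜ.indicator (Q.rnDeriv P)) :=
      (Q.measurable_rnDeriv P).indicator (hS (d + 1)).compl
    rw [ht, withDensity_add_right _ hr, withDensity_indicator (hS _),
      withDensity_indicator (hS _).compl, withDensity_add_left hm, T_succ, ih, A,
      restrict_withDensity (hS _), restrict_withDensity (hS _),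
      ← restrict_withDensity (hS _).compl, Measure.withDensity_rnDeriv_eq Q P hQP]

/-- `t_d` is a version of the Radon-Nikodym derivative `dT_d/dP`. -/
theorem t_ae_eq_rnDeriv (Q P : Measure 𝓧) [IsProbabilityMeasure Q] [IsProbabilityMeasure P]
    (hQP : Q ≪ P) (S : ℕ → Set 𝓧) (hS : ∀ d, MeasurableSet (S d)) (d : ℕ) :
    t Q P S d =ᵐ[P] (T Q P S d).rnDeriv P := by
  rw [T_eq_withDensity Q P hQP S hS d]
  exact (Measure.rnDeriv_withDensity P (measurable_t Q P S hS d)).symm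

end Recursion

/-! ## The algorithm driven by random variables -/

section Run

variable {Ω 𝓧 : Type*} [MeasurableSpace 𝓧]

/-- The heap index `I_d` reached by the branching bits: `I_0 = 1`, `I_{d+1} = 2 I_d + b_d`. -/
def heapIndex (b : ℕ → Bool) : ℕ → ℕ
  | 0 => 1
  | d + 1 => 2 * heapIndex b d + (b d).toNat

/-- The heap index `I_d` at the sample point `ω`. -/
def node (b : ℕ → Ω → Bool) (ω : Ω) (d : ℕ) : ℕ := heapIndex (fun j => b j ω) d

/-- The active sets `S_d = Z_{I_d}` at the sample point `ω`. -/
def activeSet (Z : ℕ → Ω → Set 𝓧) (b : ℕ → Ω → Bool) (ω : Ω) (d : ℕ) : Set 𝓧 :=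
  Z (node b ω d) ω

/-- The sample drawn after `d` completed steps is accepted. -/
def Accepts (Q P : Measure 𝓧) (Z : ℕ → Ω → Set 𝓧) (X : ℕ → Ω → 𝓧) (U : ℕ → Ω → ℝ)
    (b : ℕ → Ω → Bool) (d : ℕ) (ω : Ω) : Prop :=
  ENNReal.ofReal (U d ω) ≤ β Q P (activeSet Z b ω) d (X d ω)

/-- The event that the first `d` samples are all rejected, i.e. that the algorithm has not
terminated within `d` steps. -/
def alive (Q P : Measure 𝓧) (Z : ℕ → Ω → Set 𝓧) (X : ℕ → Ω → 𝓧) (U : ℕ → Ω → ℝ)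
    (b : ℕ → Ω → Bool) (d : ℕ) : Set Ω :=
  {ω | ∀ j < d, ¬ Accepts Q P Z X U b j ω}

/-- The index `D*` of the first accepted sample (with value `0` if there is none). -/
def stopIndex (Q P : Measure 𝓧) (Z : ℕ → Ω → Set 𝓧) (X : ℕ → Ω → 𝓧) (U : ℕ → Ω → ℝ)
    (b : ℕ → Ω → Bool) (ω : Ω) : ℕ :=
  sInf {d | Accepts Q P Z X U b d ω}

/-- The returned sample `X_{D*}`. -/
def returned (Q P : Measure 𝓧) (Z : ℕ → Ω → Set 𝓧) (X : ℕ → Ω → 𝓧) (U : ℕ → Ω → ℝ)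
    (b : ℕ → Ω → Bool) (ω : Ω) : 𝓧 :=
  X (stopIndex Q P Z X U b ω) ω

/-- The probability with which the coin `b_d` shows `1`, given the past. -/
def coinProb (Q P : Measure 𝓧) (Z : ℕ → Ω → Set 𝓧) (b : ℕ → Ω → Bool) (d : ℕ) (ω : Ω) : ℝ≥0∞ :=
  branchProb Q P (activeSet Z b ω) d (Z (2 * node b ω d + 1) ω)

/-- The sub-probability measure `τ_d`: `τ_d(S)` is the probability that the algorithm terminates
within `d` steps and returns a sample in `S`. -/
def τ [MeasurableSpace Ω] (μ : Measure Ω) (Q P : Measure 𝓧) (Z : ℕ → Ω → Set 𝓧) (X : ℕ → Ω → 𝓧)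
    (U : ℕ → Ω → ℝ) (b : ℕ → Ω → Bool) (d : ℕ) : Measure 𝓧 :=
  (μ.restrict (alive Q P Z X U b d)ᶜ).map (returned Q P Z X U b)

/-- `(Z, X, U, b)` is a run of Greedy Rejection Coding with target `Q` and proposal `P` on the
probability space `(Ω, μ)`. Here `ℋ d` is the information available before the draw of `X d`, `U d`,
and `𝒢 d` the information available before the toss of `b d`.

The process `Z` is arbitrary, except that the children of the current node have to be known when the
coin is tossed. So `Z` may be deterministic, random and independent of the draws, or it may split the
active set depending on earlier draws. The conditional laws are prescribed only as long as the
algorithm has not terminated. -/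
structure IsRun [mΩ : MeasurableSpace Ω] (μ : Measure Ω) (Q P : Measure 𝓧) (Z : ℕ → Ω → Set 𝓧)
    (X : ℕ → Ω → 𝓧) (U : ℕ → Ω → ℝ) (b : ℕ → Ω → Bool) (ℋ 𝒢 : ℕ → MeasurableSpace Ω) : Prop where
  partitioning : ∀ ω, IsPartitioning (fun n => Z n ω)
  le_mid : ∀ d, ℋ d ≤ 𝒢 d
  mid_le : ∀ d, 𝒢 d ≤ ℋ (d + 1)
  le_space : ∀ d, ℋ d ≤ mΩ
  measurable_X : ∀ d, Measurable[𝒢 d] (X d)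
  measurable_U : ∀ d, Measurable[𝒢 d] (U d)
  measurable_b : ∀ d, Measurable[ℋ (d + 1)] (b d)
  /-- The two children of the current node are random measurable sets, known before the toss. -/
  measurable_children : ∀ d, ∀ c : Bool,
    MeasurableSet[(𝒢 d).prod ‹MeasurableSpace 𝓧›]
      {p : Ω × 𝓧 | p.2 ∈ Z (2 * node b p.1 d + c.toNat) p.1}
  /-- Given the past, `X d ∼ P|_{S_d} / P(S_d)` and `U d ∼ Uniform(0, 1)` are independent. -/
  law_draw : ∀ d, ∀ F, MeasurableSet[ℋ d] F → ∀ B : Set 𝓧, MeasurableSet B →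
    ∀ C : Set ℝ, MeasurableSet C →
      μ (F ∩ alive Q P Z X U b d ∩ (X d ⁻¹' B ∩ U d ⁻¹' C)) =
        (∫⁻ ω in F ∩ alive Q P Z X U b d, ProbabilityTheory.cond P (activeSet Z b ω d) B ∂μ)
          * volume (C ∩ Set.Ioo 0 1)
  /-- Given the past and a rejection, `b d` is a Bernoulli variable with parameter `coinProb d`. -/
  law_coin : ∀ d, ∀ G, MeasurableSet[𝒢 d] G →
    μ (G ∩ alive Q P Z X U b (d + 1) ∩ {ω | b d ω = true}) =
      ∫⁻ ω in G ∩ alive Q P Z X U b (d + 1), coinProb Q P Z b d ω ∂μ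

/-! ## The three assumptions -/

/-- `dQ/dP` is bounded (some version of it, as it is determined only up to `P`-null sets). -/
def FiniteRatioMode (Q P : Measure 𝓧) : Prop :=
  ∃ M : ℝ, ∀ᵐ x ∂P, Q.rnDeriv P x < ENNReal.ofReal M

/-- In each partitioning step that is reached, the outcome of the coin is almost surely determined:
its success probability is `0` or `1`. -/
def SingleBranch [MeasurableSpace Ω] (μ : Measure Ω) (Q P : Measure 𝓧) (Z : ℕ → Ω → Set 𝓧)
    (X : ℕ → Ω → 𝓧) (U : ℕ → Ω → ℝ) (b : ℕ → Ω → Bool) : Prop :=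
  ∀ d, ∀ᵐ ω ∂μ, ω ∈ alive Q P Z X U b (d + 1) → coinProb Q P Z b d ω = 0 ∨ coinProb Q P Z b d ω = 1

/-- `𝓧` is a subset of some `ℝ^N` with the trace of the Borel σ-algebra, and almost surely every
nested sequence of nodes that contains a point `x`, and whose `P`-mass tends to zero, shrinks nicely
to `x`. -/
def NicelyShrinking [MeasurableSpace Ω] (μ : Measure Ω) (P : Measure 𝓧) (Z : ℕ → Ω → Set 𝓧) : Prop :=
  ∃ (N : ℕ) (ι : 𝓧 → EuclideanSpace ℝ (Fin N)), Function.Injective ι ∧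
    ‹MeasurableSpace 𝓧› = MeasurableSpace.comap ι inferInstance ∧
    ∀ᵐ ω ∂μ, ∀ (x : 𝓧) (k : ℕ → ℕ), k 0 = 1 →
      (∀ d, k (d + 1) = 2 * k d ∨ k (d + 1) = 2 * k d + 1) →
      (∀ d, x ∈ Z (k d) ω) → Tendsto (fun d => P (Z (k d) ω)) atTop (𝓝 0) →
      ∃ (γ : ℝ) (r : ℕ → ℝ), 0 < γ ∧ (∀ d, 0 < r d) ∧ Tendsto r atTop (𝓝 0) ∧
        ∀ᶠ d in atTop, Z (k d) ω ⊆ ι ⁻¹' Metric.ball (ι x) (r d) ∧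
          ENNReal.ofReal γ * P (ι ⁻¹' Metric.ball (ι x) (r d)) ≤ P (Z (k d) ω)

/-- The total variation distance `sup_S |ν₁(S) - ν₂(S)|` of two measures. -/
def tvDist (ν₁ ν₂ : Measure 𝓧) : ℝ≥0∞ :=
  ⨆ (s : Set 𝓧) (_ : MeasurableSet s), max (ν₁ s - ν₂ s) (ν₂ s - ν₁ s)

end Run

end

end GRC

/-! Write `r_d` for the part of `dQ/dP` still owed along the path (`resid`), `w_d` for its integral
(`residMass`) and `l_d = w_d / P(S_d)` for its mean over the active set (`level`). A step pays out
`min(r_d, l_d)` and leaves `(r_d - l_d)⁺`, cut down to the chosen child. Given survival so far,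
rejecting and then moving to a given child has probability `w_{d+1} / w_d`, with `w_{d+1}` the mass
left on that child. Dividing by `w_d` therefore cancels the branching: for an integrand `n` known
before step `d`, the expectation of `∫_{S_d} n / w_d` over surviving runs does not increase when
`S_d`, `w_d` become `S_{d+1}`, `w_{d+1}` (`setLIntegral_ratio_succ_le`).

Two choices of `n` carry the proof. With `n = 1_B (r_d - l_d)⁺`, the probability of having returned
a point of `B`, plus the expected share of the residual lying in `B`, never exceeds `Q B`
(`measure_returned_add_le`). With `n = 1`, the expectation of `1 / l_d` over surviving runs is at
most `1`; by Fatou the levels cannot tend to zero on a set of eternal runs of positive probability,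
so almost surely an eternal run has `∑ l_d = ∞` (`measure_iInter_alive_inter_sum_lt`).

On the other hand `r_d ≤ (dQ/dP - ∑_{j<d} l_j)⁺`. Once the sum reaches `M`, the whole residual sits
on `{dQ/dP > M}`, and by the first bound surviving in this way has probability at most `Q {dQ/dP >
M}` (`measure_alive_le`). This tends to zero as `M → ∞`, so the algorithm terminates. The law of the
returned sample is then dominated by `Q` and has the same total mass, and the total variation error
is at most the survival probability. -/

namespace GRC

/-! ### The residual density along a fixed sequence of active sets -/

section Path

variable {𝓧 : Type*} [MeasurableSpace 𝓧]

/-- The density of the part of `Q` that is not yet accounted for after `d` steps along the active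
sets `S`; see `resid_eq`. -/
noncomputable def resid (Q P : Measure 𝓧) (S : ℕ → Set 𝓧) : ℕ → 𝓧 → ℝ≥0∞
  | 0 => Q.rnDeriv P
  | d + 1 => (S (d + 1)).indicator
      (fun x => resid Q P S d x - (∫⁻ y, resid Q P S d y ∂P) / P (S d))

/-- The total mass of `Q` that is not yet accounted for after `d` steps. -/
noncomputable def residMass (Q P : Measure 𝓧) (S : ℕ → Set 𝓧) (d : ℕ) : ℝ≥0∞ :=
  ∫⁻ x, resid Q P S d x ∂P

/-- The mean of `resid` over the active set. -/
noncomputable def level (Q P : Measure 𝓧) (S : ℕ → Set 𝓧) (d : ℕ) : ℝ≥0∞ :=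
  residMass Q P S d / P (S d)

variable {Q P : Measure 𝓧} {S : ℕ → Set 𝓧}

theorem resid_succ (d : ℕ) : resid Q P S (d + 1) =
    (S (d + 1)).indicator (fun x => resid Q P S d x - level Q P S d) := rfl

/-- Each step adds at most the remaining gap. The bound is pointwise, so the truncated subtractions
`dQ/dP - t_d` lose nothing. -/
theorem t_le_rnDeriv (d : ℕ) (x : 𝓧) : t Q P S d x ≤ Q.rnDeriv P x := by
  induction d with
  | zero => simp [t, ruledOut]
  | succ d ih =>
    by_cases hx : x ∈ S (d + 1)
    · have : t Q P S (d + 1) x = t Q P S d x + α Q P S d x := by simp [t, ruledOut, hx, α, T]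
      rw [this]
      calc _ ≤ t Q P S d x + (Q.rnDeriv P x - t Q P S d x) := by
            gcongr; exact min_le_left _ _
        _ = _ := add_tsub_cancel_of_le ih
    · have : t Q P S (d + 1) x = Q.rnDeriv P x := by simp [t, ruledOut, hx]
      exact this.le

variable [IsProbabilityMeasure Q] [IsProbabilityMeasure P]

theorem lintegral_t_ne_top (hQP : Q ≪ P) (d : ℕ) (s : Set 𝓧) :
    ∫⁻ x in s, t Q P S d x ∂P ≠ ∞ := by
  refine ne_top_of_le_ne_top (measure_ne_top Q s) ?_
  rw [← Measure.setLIntegral_rnDeriv hQP]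
  exact lintegral_mono fun x => t_le_rnDeriv d x

theorem one_sub_T_eq (hQP : Q ≪ P) (hS : ∀ d, MeasurableSet (S d)) (d : ℕ) :
    1 - T Q P S d Set.univ = ∫⁻ x, (Q.rnDeriv P x - t Q P S d x) ∂P := by
  have h := lintegral_t_ne_top (S := S) hQP d Set.univ
  rw [Measure.restrict_univ] at h
  rw [lintegral_sub (measurable_t Q P S hS d) h (Eventually.of_forall (t_le_rnDeriv d)),
    Measure.lintegral_rnDeriv hQP, T_eq_withDensity Q P hQP S hS]
  simp

/-- Links the short recursion to the algorithm: `r - min(r, l)` is the truncated `r - l`, and off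
the new active set `t_{d+1} = dQ/dP` leaves nothing owed. -/
theorem resid_eq (hQP : Q ≪ P) (hS : ∀ d, MeasurableSet (S d)) (d : ℕ) (x : 𝓧) :
    resid Q P S d x = Q.rnDeriv P x - t Q P S d x := by
  induction d generalizing x with
  | zero => simp [resid, t, ruledOut]
  | succ d ih =>
    have hw : residMass Q P S d = 1 - T Q P S d Set.univ := by
      rw [one_sub_T_eq hQP hS]; exact lintegral_congr ih
    by_cases hx : x ∈ S (d + 1)
    · have : t Q P S (d + 1) x = t Q P S d x + α Q P S d x := by simp [t, ruledOut, hx, α, T]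
      rw [this, resid_succ, Set.indicator_of_mem hx, ih, ← tsub_tsub, level, hw, α, greedyDensity]
      rcases le_total (Q.rnDeriv P x - t Q P S d x) ((1 - T Q P S d Set.univ) / P (S d)) with h | h
      · rw [min_eq_left h, tsub_self, tsub_eq_zero_of_le h]
      · rw [min_eq_right h]
    · have : t Q P S (d + 1) x = Q.rnDeriv P x := by simp [t, ruledOut, hx]
      rw [this, resid_succ, Set.indicator_of_notMem hx, tsub_self]

theorem residMass_eq (hQP : Q ≪ P) (hS : ∀ d, MeasurableSet (S d)) (d : ℕ) :
    residMass Q P S d = 1 - T Q P S d Set.univ := by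
  rw [one_sub_T_eq hQP hS]; exact lintegral_congr (resid_eq hQP hS d)

theorem α_eq (hQP : Q ≪ P) (hS : ∀ d, MeasurableSet (S d)) (d : ℕ) (x : 𝓧) :
    α Q P S d x = min (resid Q P S d x) (level Q P S d) := by
  rw [α, greedyDensity, resid_eq hQP hS, level, residMass_eq hQP hS]

theorem β_eq (hQP : Q ≪ P) (hS : ∀ d, MeasurableSet (S d)) (d : ℕ) (x : 𝓧) :
    β Q P S d x = min (resid Q P S d x) (level Q P S d) * (P (S d) / residMass Q P S d) := by
  rw [β, α_eq hQP hS, residMass_eq hQP hS]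

omit [IsProbabilityMeasure Q] [IsProbabilityMeasure P] in
theorem measurable_resid (hS : ∀ d, MeasurableSet (S d)) (d : ℕ) :
    Measurable (resid Q P S d) := by
  cases d with
  | zero => exact Q.measurable_rnDeriv P
  | succ d =>
    exact ((measurable_resid hS d).sub measurable_const).indicator (hS _)

omit [IsProbabilityMeasure Q] [IsProbabilityMeasure P] in
-- Passing to a child only decreases the residual, so the truncated subtractions of the levels
-- accumulate.
theorem resid_le_rnDeriv_sub_sum (d : ℕ) (x : 𝓧) :
    resid Q P S d x ≤ Q.rnDeriv P x - ∑ j ∈ Finset.range d, level Q P S j := by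
  induction d with
  | zero => simp [resid]
  | succ d ih =>
    rw [Finset.sum_range_succ, ← tsub_tsub, resid_succ]
    exact (Set.indicator_le_self _ _ x).trans (tsub_le_tsub_right ih _)

theorem residMass_ne_top (hQP : Q ≪ P) (d : ℕ) : residMass Q P S d ≠ ∞ := by
  refine ne_top_of_le_ne_top ENNReal.one_ne_top ?_
  rw [← measure_univ (μ := Q), ← Measure.lintegral_rnDeriv hQP]
  exact lintegral_mono fun x => (resid_le_rnDeriv_sub_sum d x).trans tsub_le_self

theorem setLIntegral_rejected (hQP : Q ≪ P) (hS : ∀ d, MeasurableSet (S d)) (d : ℕ)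
    {s : Set 𝓧} (hs : MeasurableSet s) :
    Q s - T Q P S d s - A Q P S d s = ∫⁻ x in s, (resid Q P S d x - level Q P S d) ∂P := by
  have ht := measurable_t Q P S hS d
  have hα : Measurable (α Q P S d) := by
    rw [funext (α_eq hQP hS d)]; exact (measurable_resid hS d).min measurable_const
  have hle : ∀ x, α Q P S d x ≤ Q.rnDeriv P x - t Q P S d x := fun x => min_le_left _ _
  rw [T_eq_withDensity Q P hQP S hS, A, withDensity_apply _ hs, withDensity_apply _ hs,
    ← Measure.setLIntegral_rnDeriv hQP,
    ← lintegral_sub ht (lintegral_t_ne_top hQP d s) (Eventually.of_forall (t_le_rnDeriv d)),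
    ← lintegral_sub hα _ (Eventually.of_forall hle)]
  · refine lintegral_congr fun x => ?_
    rw [α_eq hQP hS, ← resid_eq hQP hS]
    rcases le_total (resid Q P S d x) (level Q P S d) with h | h
    · rw [min_eq_left h, tsub_self, tsub_eq_zero_of_le h]
    · rw [min_eq_right h]
  · refine ne_top_of_le_ne_top (measure_ne_top Q s) ?_
    rw [← Measure.setLIntegral_rnDeriv hQP]
    exact lintegral_mono fun x => (hle x).trans tsub_le_self

theorem branchProb_eq (hQP : Q ≪ P) (hS : ∀ d, MeasurableSet (S d)) (d : ℕ)
    {s : Set 𝓧} (hs : MeasurableSet s) :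
    branchProb Q P S d s = (∫⁻ x in s, (resid Q P S d x - level Q P S d) ∂P) /
      ∫⁻ x in S d, (resid Q P S d x - level Q P S d) ∂P := by
  rw [branchProb, setLIntegral_rejected hQP hS d hs, setLIntegral_rejected hQP hS d (hS d)]

omit [IsProbabilityMeasure Q] [IsProbabilityMeasure P] in
theorem residMass_succ (hS : ∀ d, MeasurableSet (S d)) (d : ℕ) :
    residMass Q P S (d + 1) = ∫⁻ x in S (d + 1), (resid Q P S d x - level Q P S d) ∂P := by
  rw [residMass, resid_succ, lintegral_indicator (hS _)]

omit [IsProbabilityMeasure Q] [IsProbabilityMeasure P] in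
theorem resid_eq_zero_of_notMem (h0 : S 0 = Set.univ) (d : ℕ) {x : 𝓧} (hx : x ∉ S d) :
    resid Q P S d x = 0 := by
  cases d with
  | zero => simp [h0] at hx
  | succ d => rw [resid_succ, Set.indicator_of_notMem hx]

omit [IsProbabilityMeasure Q] [IsProbabilityMeasure P] in
theorem setLIntegral_resid (hS : ∀ d, MeasurableSet (S d)) (h0 : S 0 = Set.univ) (d : ℕ) :
    ∫⁻ x in S d, resid Q P S d x ∂P = residMass Q P S d := by
  rw [← lintegral_indicator (hS d), residMass]
  refine lintegral_congr fun x => ?_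
  by_cases hx : x ∈ S d
  · rw [Set.indicator_of_mem hx]
  · rw [Set.indicator_of_notMem hx, resid_eq_zero_of_notMem h0 d hx]

omit [IsProbabilityMeasure Q] [IsProbabilityMeasure P] in
theorem measure_active_ne_zero (hS : ∀ d, MeasurableSet (S d)) (h0 : S 0 = Set.univ) {d : ℕ}
    (hw : residMass Q P S d ≠ 0) : P (S d) ≠ 0 := by
  intro hp
  rw [← setLIntegral_resid hS h0, Measure.restrict_eq_zero.2 hp] at hw
  simp at hw

/-- The factor in `β` is the reciprocal of the level, so `β` is `min(r, l) / l`, a genuine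
probability. -/
theorem level_mul (hQP : Q ≪ P) (hS : ∀ d, MeasurableSet (S d)) (h0 : S 0 = Set.univ) {d : ℕ}
    (hw : residMass Q P S d ≠ 0) : level Q P S d * (P (S d) / residMass Q P S d) = 1 := by
  rw [level, ← mul_div_assoc, ENNReal.div_mul_cancel (measure_active_ne_zero hS h0 hw)
    (measure_ne_top _ _), ENNReal.div_self hw (residMass_ne_top hQP d)]

theorem β_le_one (hQP : Q ≪ P) (hS : ∀ d, MeasurableSet (S d)) (h0 : S 0 = Set.univ) {d : ℕ}
    (hw : residMass Q P S d ≠ 0) (x : 𝓧) : β Q P S d x ≤ 1 := by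
  rw [β_eq hQP hS, ← level_mul hQP hS h0 hw]
  gcongr
  exact min_le_right _ _

theorem measurable_β (hQP : Q ≪ P) (hS : ∀ d, MeasurableSet (S d)) (d : ℕ) :
    Measurable (β Q P S d) := by
  rw [funext (β_eq hQP hS d)]
  exact ((measurable_resid hS d).min measurable_const).mul_const _

/-- On a step that can be reached, the conditional probability of accepting a sample in `B`. -/
theorem inv_mul_setLIntegral_β (hQP : Q ≪ P) (hS : ∀ d, MeasurableSet (S d))
    (h0 : S 0 = Set.univ) (d : ℕ) (hw : residMass Q P S d ≠ 0) {B : Set 𝓧} (hB : MeasurableSet B) :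
    (P (S d))⁻¹ * ∫⁻ x in S d, B.indicator (β Q P S d) x ∂P =
      (∫⁻ x in B, min (resid Q P S d x) (level Q P S d) ∂P) / residMass Q P S d := by
  have hp := measure_active_ne_zero hS h0 hw
  have hm : Measurable fun x => min (resid Q P S d x) (level Q P S d) :=
    (measurable_resid hS d).min measurable_const
  -- The residual, hence `β`, vanishes off `S d`, so the integral over `B ∩ S d` is the one over
  -- `B`.
  have h1 : ∫⁻ x in S d, B.indicator (β Q P S d) x ∂P =
      (∫⁻ x in B, min (resid Q P S d x) (level Q P S d) ∂P) * (P (S d) / residMass Q P S d) := by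
    rw [← lintegral_mul_const _ hm, ← lintegral_indicator (hS d), ← lintegral_indicator hB]
    refine lintegral_congr fun x => ?_
    by_cases hx : x ∈ S d <;> by_cases hxB : x ∈ B <;>
      simp [hx, hxB, β_eq hQP hS, resid_eq_zero_of_notMem h0]
  rw [h1, div_eq_mul_inv, div_eq_mul_inv, mul_left_comm, ← mul_assoc (P (S d))⁻¹,
    ENNReal.inv_mul_cancel hp (measure_ne_top _ _), one_mul]

/-- On a step that can be reached, the conditional rejection probability is the share of the
remaining mass that is left after the step. -/
theorem inv_mul_setLIntegral_one_sub_β (hQP : Q ≪ P) (hS : ∀ d, MeasurableSet (S d))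
    (h0 : S 0 = Set.univ) (d : ℕ) (hw : residMass Q P S d ≠ 0) :
    (P (S d))⁻¹ * ∫⁻ x in S d, (1 - β Q P S d x) ∂P =
      (∫⁻ x in S d, (resid Q P S d x - level Q P S d) ∂P) / residMass Q P S d := by
  have hp := measure_active_ne_zero hS h0 hw
  have hm : Measurable fun x => min (resid Q P S d x) (level Q P S d) :=
    (measurable_resid hS d).min measurable_const
  have hβ : ∫⁻ x in S d, β Q P S d x ∂P ≠ ∞ := by
    refine ne_top_of_le_ne_top (measure_ne_top P (S d)) ?_
    rw [← setLIntegral_one]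
    exact lintegral_mono fun x => β_le_one hQP hS h0 hw x
  have h1 := inv_mul_setLIntegral_β hQP hS h0 d hw (hS d)
  rw [setLIntegral_congr_fun (g := β Q P S d) (hS d)
    fun x hx => Set.indicator_of_mem hx _] at h1
  have h2 : ∫⁻ x in S d, (resid Q P S d x - level Q P S d) ∂P =
      residMass Q P S d - ∫⁻ x in S d, min (resid Q P S d x) (level Q P S d) ∂P := by
    rw [← setLIntegral_resid hS h0, ← lintegral_sub hm]
    · refine lintegral_congr fun x => ?_
      rcases le_total (resid Q P S d x) (level Q P S d) with h | h
      · rw [min_eq_left h, tsub_self, tsub_eq_zero_of_le h]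
      · rw [min_eq_right h]
    · refine ne_top_of_le_ne_top (residMass_ne_top (S := S) hQP d) ?_
      rw [← setLIntegral_resid hS h0]
      exact lintegral_mono fun x => min_le_left _ _
    · exact Eventually.of_forall fun x => min_le_left _ _
  rw [lintegral_sub (measurable_β hQP hS d) hβ
    (Eventually.of_forall (β_le_one hQP hS h0 hw)), setLIntegral_one,
    ENNReal.mul_sub fun _ _ => ENNReal.inv_ne_top.2 hp,
    ENNReal.inv_mul_cancel hp (measure_ne_top _ _), h1, h2, ENNReal.sub_div fun _ _ => hw,
    ENNReal.div_self hw (residMass_ne_top hQP d)]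

end Path

/-! ### Joint measurability in the sample point and the space variable -/

section JointMeasurability

variable {Ω 𝓧 : Type*} {mΩ : MeasurableSpace Ω} [MeasurableSpace 𝓧]
  {Q P : Measure 𝓧} [IsProbabilityMeasure P] {S : Ω → ℕ → Set 𝓧}

theorem measurable_measure_active {d : ℕ} (hS : MeasurableSet {p : Ω × 𝓧 | p.2 ∈ S p.1 d}) :
    Measurable fun ω => P (S ω d) :=
  measurable_measure_prodMk_left hS

/-- Only the active sets up to time `d` enter, which is why the lemma can be applied with the
σ-algebra `ℋ d` of the past. -/
theorem measurable_resid_prod {d : ℕ}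
    (hS : ∀ j ≤ d, MeasurableSet {p : Ω × 𝓧 | p.2 ∈ S p.1 j}) :
    Measurable fun p : Ω × 𝓧 => resid Q P (S p.1) d p.2 := by
  induction d with
  | zero => exact (Q.measurable_rnDeriv P).comp measurable_snd
  | succ d ih =>
    have h1 := ih fun j hj => hS j (hj.trans d.le_succ)
    have h2 : Measurable fun ω => level Q P (S ω) d :=
      h1.lintegral_prod_right'.div (measurable_measure_active (hS d d.le_succ))
    have h3 := (h1.sub (h2.comp measurable_fst)).indicator (hS (d + 1) le_rfl)
    exact h3

theorem measurable_residMass {d : ℕ}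
    (hS : ∀ j ≤ d, MeasurableSet {p : Ω × 𝓧 | p.2 ∈ S p.1 j}) :
    Measurable fun ω => residMass Q P (S ω) d :=
  (measurable_resid_prod hS).lintegral_prod_right'

theorem measurable_level {d : ℕ}
    (hS : ∀ j ≤ d, MeasurableSet {p : Ω × 𝓧 | p.2 ∈ S p.1 j}) :
    Measurable fun ω => level Q P (S ω) d :=
  (measurable_residMass hS).div (measurable_measure_active (hS d le_rfl))

theorem measurable_setLIntegral {s : Ω → Set 𝓧} (hs : MeasurableSet {p : Ω × 𝓧 | p.2 ∈ s p.1})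
    {n : Ω → 𝓧 → ℝ≥0∞} (hn : Measurable (Function.uncurry n)) :
    Measurable fun ω => ∫⁻ x in s ω, n ω x ∂P := by
  have h := (hn.indicator hs).lintegral_prod_right' (ν := P)
  convert h using 2 with ω
  have hm : MeasurableSet (s ω) := measurable_prodMk_left hs
  rw [← lintegral_indicator hm]
  rfl

end JointMeasurability

/-! ### From conditional laws on events to integrals -/

section Disintegration

variable {Ω Ω' 𝓧 : Type*} {mΩ : MeasurableSpace Ω} {mΩ' : MeasurableSpace Ω'} [MeasurableSpace 𝓧]

/-- A conditional law that is prescribed on rectangles determines the integrals of all functions of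
the past and the draw. -/
theorem lintegral_draw {μ : Measure Ω} [IsFiniteMeasure μ] {P : Measure 𝓧} [IsProbabilityMeasure P]
    {π : Ω → Ω'} (hπ : Measurable π) {X : Ω → 𝓧} (hX : Measurable X) {U : Ω → ℝ}
    (hU : Measurable U) {s : Ω' → Set 𝓧} (hs : MeasurableSet {p : Ω' × 𝓧 | p.2 ∈ s p.1})
    (h : ∀ F, MeasurableSet F → ∀ B, MeasurableSet B → ∀ C, MeasurableSet C →
      μ (π ⁻¹' F ∩ (X ⁻¹' B ∩ U ⁻¹' C)) =
        (∫⁻ ω in π ⁻¹' F, ProbabilityTheory.cond P (s (π ω)) B ∂μ) * volume (C ∩ Set.Ioo 0 1))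
    {φ : Ω' × 𝓧 × ℝ → ℝ≥0∞} (hφ : Measurable φ) :
    ∫⁻ ω, φ (π ω, X ω, U ω) ∂μ =
      ∫⁻ ω, (P (s (π ω)))⁻¹ * ∫⁻ x in s (π ω), (∫⁻ u in Set.Ioo (0 : ℝ) 1, φ (π ω, x, u)) ∂P ∂μ := by
  -- `k` is the density of the conditional law of the draw with respect to `P ⊗ Uniform(0, 1)`.
  let k : Ω' × 𝓧 × ℝ → ℝ≥0∞ :=
    fun z => {p : Ω' × 𝓧 | p.2 ∈ s p.1}.indicator (fun p => (P (s p.1))⁻¹) (z.1, z.2.1)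
  have hk : Measurable k :=
    Measurable.comp (((measurable_measure_prodMk_left hs).inv.comp measurable_fst).indicator hs)
      (by fun_prop)
  let ν := ((μ.map π).prod (P.prod (volume.restrict (Set.Ioo (0 : ℝ) 1)))).withDensity k
  have key : ∀ ψ : Ω' × 𝓧 × ℝ → ℝ≥0∞, Measurable ψ → ∫⁻ z, ψ z ∂ν =
      ∫⁻ ω, (P (s (π ω)))⁻¹ *
        ∫⁻ x in s (π ω), (∫⁻ u in Set.Ioo (0 : ℝ) 1, ψ (π ω, x, u)) ∂P ∂μ := by
    intro ψ hψ
    have hkψ := hk.mul hψ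
    rw [lintegral_withDensity_eq_lintegral_mul _ hk hψ, lintegral_prod _ hkψ.aemeasurable,
      lintegral_map hkψ.lintegral_prod_right' hπ]
    refine lintegral_congr fun ω => ?_
    have hm : MeasurableSet (s (π ω)) := measurable_prodMk_left hs
    have hψω : Measurable fun z : 𝓧 × ℝ => ψ (π ω, z) := hψ.comp measurable_prodMk_left
    have hkψω : Measurable fun z : 𝓧 × ℝ => (k * ψ) (π ω, z) := hkψ.comp measurable_prodMk_left
    rw [lintegral_prod _ hkψω.aemeasurable,
      ← lintegral_indicator hm,
      ← lintegral_const_mul _ (hψω.lintegral_prod_right'.indicator hm)]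
    refine lintegral_congr fun x => ?_
    by_cases hx : x ∈ s (π ω)
    · have hψx : Measurable fun u : ℝ => ψ (π ω, x, u) := hψω.comp measurable_prodMk_left
      rw [Set.indicator_of_mem hx, ← lintegral_const_mul _ hψx]
      refine lintegral_congr fun u => ?_
      have : (π ω, x) ∈ {p : Ω' × 𝓧 | p.2 ∈ s p.1} := hx
      simp [k, this]
    · have : (π ω, x) ∉ {p : Ω' × 𝓧 | p.2 ∈ s p.1} := hx
      simp [k, this, hx]
  have hY : Measurable fun ω => (π ω, X ω, U ω) := hπ.prodMk (hX.prodMk hU)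
  -- Both measures are compared on boxes `F × B × C`, where the hypothesis applies.
  have hν : μ.map (fun ω => (π ω, X ω, U ω)) = ν := by
    refine Measure.ext_prod₃ fun {F B C} hF hB hC => ?_
    have hFBC := hF.prod (hB.prod hC)
    rw [Measure.map_apply hY hFBC, ← lintegral_indicator_one (μ := ν) hFBC,
      key _ (measurable_one.indicator hFBC)]
    have := h F hF B hB C hC
    refine (congrArg μ ?_).trans (this.trans ?_)
    · ext ω; simp
    · rw [← lintegral_indicator (hπ hF), ← lintegral_mul_const']
      · refine lintegral_congr fun ω => ?_
        by_cases hω : π ω ∈ F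
        · have h1 : ∀ x u, (F ×ˢ B ×ˢ C).indicator (1 : Ω' × 𝓧 × ℝ → ℝ≥0∞) (π ω, x, u) =
              B.indicator 1 x * C.indicator 1 u := by
            intro x u
            by_cases hx : x ∈ B <;> by_cases hu : u ∈ C <;> simp [hω, hx, hu]
          have h2 : MeasurableSet (s (π ω)) := measurable_prodMk_left hs
          simp_rw [h1]
          have h3 : ∀ x, ∫⁻ u in Set.Ioo (0 : ℝ) 1, B.indicator (1 : 𝓧 → ℝ≥0∞) x *
              C.indicator 1 u = B.indicator 1 x * volume (C ∩ Set.Ioo 0 1) := by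
            intro x
            rw [lintegral_const_mul _ (measurable_one.indicator hC), lintegral_indicator_one hC,
              Measure.restrict_apply hC]
          simp_rw [h3]
          rw [lintegral_mul_const _ (measurable_one.indicator hB), lintegral_indicator_one hB,
            Measure.restrict_apply hB, Set.indicator_of_mem (by exact hω), cond_apply h2,
            Set.inter_comm B, mul_assoc]
        · have h1 : ∀ x u, (F ×ˢ B ×ˢ C).indicator (1 : Ω' × 𝓧 × ℝ → ℝ≥0∞) (π ω, x, u) = 0 := by
            intro x u; simp [hω]
          rw [Set.indicator_of_notMem (by exact hω)]
          simp [h1]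
      · exact ne_top_of_le_ne_top (by simp) (measure_mono Set.inter_subset_right)
  rw [← key φ hφ, ← hν, lintegral_map hφ hY]

/-- The image of `μ` under `π` has density `p` with respect to that of `ν`. The target `Ω'` is kept
separate so that `π` can be the identity onto `Ω` with a coarser σ-algebra. -/
theorem lintegral_of_setLIntegral {μ ν : Measure Ω} [IsFiniteMeasure μ]
    {π : Ω → Ω'} (hπ : Measurable π) {p : Ω' → ℝ≥0∞} (hp : Measurable p)
    (h : ∀ F, MeasurableSet F → μ (π ⁻¹' F) = ∫⁻ ω in π ⁻¹' F, p (π ω) ∂ν)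
    {g : Ω' → ℝ≥0∞} (hg : Measurable g) :
    ∫⁻ ω, g (π ω) ∂μ = ∫⁻ ω, p (π ω) * g (π ω) ∂ν := by
  have hμ : μ.map π = (ν.map π).withDensity p := by
    ext F hF
    rw [Measure.map_apply hπ hF, h F hF, withDensity_apply _ hF, setLIntegral_map hF hp hπ]
  rw [← lintegral_map hg hπ, hμ, lintegral_withDensity_eq_lintegral_mul _ hp hg,
    lintegral_map (hp.mul hg) hπ]
  rfl

end Disintegration

/-! ### Acceptance thresholds for a uniform variable, and the mass left after a rejection -/

theorem volume_lt_ofReal (c : ℝ≥0∞) :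
    volume ({u : ℝ | c < ENNReal.ofReal u} ∩ Set.Ioo 0 1) = 1 - c := by
  rcases eq_or_ne c ∞ with rfl | hc
  · simp
  · have : {u : ℝ | c < ENNReal.ofReal u} ∩ Set.Ioo 0 1 = Set.Ioo c.toReal 1 := by
      ext u
      simp only [Set.mem_inter_iff, Set.mem_ofPred_eq, Set.mem_Ioo,
        ENNReal.lt_ofReal_iff_toReal_lt hc]
      have := ENNReal.toReal_nonneg (a := c)
      constructor
      · rintro ⟨h1, -, h2⟩; exact ⟨h1, h2⟩
      · rintro ⟨h1, h2⟩; exact ⟨h1, this.trans_lt h1, h2⟩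
    rw [this, Real.volume_Ioo, ENNReal.ofReal_sub _ ENNReal.toReal_nonneg, ENNReal.ofReal_one,
      ENNReal.ofReal_toReal hc]

theorem volume_ofReal_le {c : ℝ≥0∞} (hc : c ≤ 1) :
    volume ({u : ℝ | ENNReal.ofReal u ≤ c} ∩ Set.Ioo 0 1) = c := by
  have hc' : c ≠ ∞ := ne_top_of_le_ne_top ENNReal.one_ne_top hc
  have h1 : MeasurableSet {u : ℝ | ENNReal.ofReal u ≤ c} :=
    measurableSet_le ENNReal.measurable_ofReal measurable_const
  -- Adding the null endpoint `1` makes the set equal to `Ioc 0 c` also when `c = 1`.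
  rw [← Measure.restrict_apply h1, restrict_Ioo_eq_restrict_Ioc, Measure.restrict_apply h1]
  have : {u : ℝ | ENNReal.ofReal u ≤ c} ∩ Set.Ioc 0 1 = Set.Ioc 0 c.toReal := by
    ext u
    have h2 : c.toReal ≤ 1 := ENNReal.toReal_le_of_le_ofReal zero_le_one (by simpa using hc)
    simp only [Set.mem_inter_iff, Set.mem_ofPred_eq, Set.mem_Ioc,
      ENNReal.ofReal_le_iff_le_toReal hc']
    constructor
    · rintro ⟨h1, h3, -⟩; exact ⟨h3, h1⟩
    · rintro ⟨h1, h3⟩; exact ⟨h3, h1, h3.trans h2⟩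
  rw [this, Real.volume_Ioc, sub_zero, ENNReal.ofReal_toReal hc']

/-- The mass of `Q` on `s` that is not accounted for by the first `d + 1` steps. -/
noncomputable def rejMass {𝓧 : Type*} [MeasurableSpace 𝓧] (Q P : Measure 𝓧) (S : ℕ → Set 𝓧) (d : ℕ)
    (s : Set 𝓧) : ℝ≥0∞ :=
  ∫⁻ x in s, (resid Q P S d x - level Q P S d) ∂P

theorem rejMass_ne_top {𝓧 : Type*} [MeasurableSpace 𝓧] {Q P : Measure 𝓧} [IsProbabilityMeasure Q]
    [IsProbabilityMeasure P] {S : ℕ → Set 𝓧} (hQP : Q ≪ P) (d : ℕ) (s : Set 𝓧) :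
    rejMass Q P S d s ≠ ∞ := by
  refine ne_top_of_le_ne_top (residMass_ne_top (S := S) hQP d) ?_
  exact (setLIntegral_le_lintegral _ _).trans (lintegral_mono fun x => tsub_le_self)

section

variable {Ω 𝓧 : Type*} {mΩ : MeasurableSpace Ω} [MeasurableSpace 𝓧]

theorem measurableSet_lt_ofReal {f : Ω × 𝓧 → ℝ≥0∞} (hf : Measurable f) :
    MeasurableSet {z : Ω × 𝓧 × ℝ | f (z.1, z.2.1) < ENNReal.ofReal z.2.2} :=
  measurableSet_lt (by fun_prop) (by fun_prop)

theorem measurableSet_ofReal_le_inter {f : Ω × 𝓧 → ℝ≥0∞} (hf : Measurable f) {B : Set 𝓧}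
    (hB : MeasurableSet B) : MeasurableSet
      ({z : Ω × 𝓧 × ℝ | ENNReal.ofReal z.2.2 ≤ f (z.1, z.2.1)} ∩ {z | z.2.1 ∈ B}) :=
  (measurableSet_le (by fun_prop) (by fun_prop)).inter
    ((measurable_fst.comp measurable_snd) hB)

end

/-! ### Measurability of a run and the law of a draw -/

section Run

variable {Ω 𝓧 : Type*} [mΩ : MeasurableSpace Ω] [MeasurableSpace 𝓧]
  {μ : Measure Ω} {Q P : Measure 𝓧} {Z : ℕ → Ω → Set 𝓧} {X : ℕ → Ω → 𝓧} {U : ℕ → Ω → ℝ} {b : ℕ → Ω → Bool}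
  {ℋ 𝒢 : ℕ → MeasurableSpace Ω}

omit mΩ [MeasurableSpace 𝓧] in
theorem activeSet_succ (d : ℕ) (ω : Ω) :
    activeSet Z b ω (d + 1) = Z (2 * node b ω d + (b d ω).toNat) ω := rfl

omit mΩ in
theorem alive_succ (d : ℕ) :
    alive Q P Z X U b (d + 1) = alive Q P Z X U b d ∩ {ω | Accepts Q P Z X U b d ω}ᶜ := by
  ext ω
  simp only [alive, Nat.lt_succ_iff_lt_or_eq, Set.mem_ofPred_eq, Set.mem_inter_iff,
    Set.mem_compl_iff]
  constructor
  · exact fun h => ⟨fun j hj => h j (Or.inl hj), h d (Or.inr rfl)⟩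
  · rintro ⟨h1, h2⟩ j (hj | rfl)
    exacts [h1 j hj, h2]

omit mΩ in
theorem one_le_node (b : ℕ → Ω → Bool) (ω : Ω) (d : ℕ) : 1 ≤ node b ω d := by
  induction d with
  | zero => exact le_rfl
  | succ d ih =>
    have : node b ω (d + 1) = 2 * node b ω d + (b d ω).toNat := rfl
    omega

namespace IsRun

variable (h : IsRun μ Q P Z X U b ℋ 𝒢)
include h

theorem activeSet_zero (ω : Ω) : activeSet Z b ω 0 = Set.univ := (h.partitioning ω).root

theorem measurableSet_activeSet (ω : Ω) (d : ℕ) : MeasurableSet (activeSet Z b ω d) :=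
  (h.partitioning ω).measurableSet _ (one_le_node b ω d)

theorem measurableSet_child (ω : Ω) (d : ℕ) (c : Bool) :
    MeasurableSet (Z (2 * node b ω d + c.toNat) ω) :=
  (h.partitioning ω).measurableSet _ (by have := one_le_node b ω d; omega)

theorem setLIntegral_children (ω : Ω) (d : ℕ) (f : 𝓧 → ℝ≥0∞) :
    ∫⁻ x in Z (2 * node b ω d + true.toNat) ω, f x ∂P +
      ∫⁻ x in Z (2 * node b ω d + false.toNat) ω, f x ∂P = ∫⁻ x in activeSet Z b ω d, f x ∂P := by
  have hn := one_le_node b ω d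
  have h1 := (h.partitioning ω).disjoint _ hn
  have h2 := (h.partitioning ω).union _ hn
  rw [activeSet, ← h2, add_comm, lintegral_union]
  · rfl
  · exact h.measurableSet_child ω d true
  · exact Set.disjoint_iff_inter_eq_empty.2 h1

theorem monotone_past : Monotone ℋ :=
  monotone_nat_of_le_succ fun d => (h.le_mid d).trans (h.mid_le d)

theorem mid_le_space (d : ℕ) : 𝒢 d ≤ mΩ := (h.mid_le d).trans (h.le_space _)

/-- Split according to the value of `b d`: both candidate children are known at `𝒢 d`, and the coin
itself at `ℋ (d + 1)`. -/
theorem measurableSet_active_prod (d : ℕ) :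
    MeasurableSet[(ℋ d).prod inferInstance] {p : Ω × 𝓧 | p.2 ∈ activeSet Z b p.1 d} := by
  cases d with
  | zero => simp [h.activeSet_zero]
  | succ d =>
    have hle : (𝒢 d).prod ‹MeasurableSpace 𝓧› ≤ (ℋ (d + 1)).prod inferInstance :=
      sup_le_sup (MeasurableSpace.comap_mono (h.mid_le d)) le_rfl
    have hb : ∀ c, MeasurableSet[(ℋ (d + 1)).prod inferInstance] {p : Ω × 𝓧 | b d p.1 = c} :=
      fun c => (@measurable_fst _ _ (ℋ (d + 1)) _) (h.measurable_b d (measurableSet_singleton c))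
    have : {p : Ω × 𝓧 | p.2 ∈ activeSet Z b p.1 (d + 1)} =
        ⋃ c, {p | b d p.1 = c} ∩ {p | p.2 ∈ Z (2 * node b p.1 d + c.toNat) p.1} := by
      ext p; simp [activeSet_succ]
    rw [this]
    exact MeasurableSet.iUnion fun c => (hb c).inter (hle _ (h.measurable_children d c))

theorem measurableSet_active_prod_of_le {j d : ℕ} (hj : j ≤ d) :
    MeasurableSet[(ℋ d).prod inferInstance] {p : Ω × 𝓧 | p.2 ∈ activeSet Z b p.1 j} :=
  sup_le_sup (MeasurableSpace.comap_mono (h.monotone_past hj)) le_rfl _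
    (h.measurableSet_active_prod j)

theorem prod_past_le_mid (d : ℕ) :
    (ℋ d).prod ‹MeasurableSpace 𝓧› ≤ (𝒢 d).prod inferInstance :=
  sup_le_sup (MeasurableSpace.comap_mono (h.le_mid d)) le_rfl

variable [IsProbabilityMeasure P]

theorem measurable_resid_past (d : ℕ) : Measurable[(ℋ d).prod inferInstance]
    fun p : Ω × 𝓧 => resid Q P (activeSet Z b p.1) d p.2 :=
  measurable_resid_prod (mΩ := ℋ d) fun _ hj => h.measurableSet_active_prod_of_le hj

theorem measurable_residMass_past (d : ℕ) :
    Measurable[ℋ d] fun ω => residMass Q P (activeSet Z b ω) d :=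
  measurable_residMass (mΩ := ℋ d) fun _ hj => h.measurableSet_active_prod_of_le hj

theorem measurable_level_past (d : ℕ) :
    Measurable[ℋ d] fun ω => level Q P (activeSet Z b ω) d :=
  measurable_level (mΩ := ℋ d) fun _ hj => h.measurableSet_active_prod_of_le hj

theorem measurable_resid_sub_level (d : ℕ) : Measurable[(ℋ d).prod inferInstance]
    fun p : Ω × 𝓧 => resid Q P (activeSet Z b p.1) d p.2 - level Q P (activeSet Z b p.1) d :=
  (h.measurable_resid_past d).sub
    ((h.measurable_level_past d).comp (@measurable_fst _ _ (ℋ d) _))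

variable [IsProbabilityMeasure Q]

theorem measurable_β_past (hQP : Q ≪ P) (d : ℕ) : Measurable[(ℋ d).prod inferInstance]
    fun p : Ω × 𝓧 => β Q P (activeSet Z b p.1) d p.2 := by
  simp_rw [fun ω x => β_eq hQP (h.measurableSet_activeSet ω) d x]
  have h1 := h.measurable_level_past d
  have h2 := h.measurable_residMass_past d
  have h3 := measurable_measure_active (P := P) (mΩ := ℋ d) (h.measurableSet_active_prod d)
  have hf := @measurable_fst _ _ (ℋ d) ‹MeasurableSpace 𝓧›
  exact ((h.measurable_resid_past d).min (h1.comp hf)).mul ((h3.comp hf).div (h2.comp hf))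

theorem measurableSet_accepts (hQP : Q ≪ P) (d : ℕ) :
    MeasurableSet[𝒢 d] {ω | Accepts Q P Z X U b d ω} := by
  have h1 : Measurable[𝒢 d] fun ω => β Q P (activeSet Z b ω) d (X d ω) := by
    have h2 := (@measurable_id _ (𝒢 d)).prodMk (h.measurable_X d)
    exact ((h.measurable_β_past hQP d).mono (h.prod_past_le_mid d) le_rfl).comp h2
  exact measurableSet_le (ENNReal.measurable_ofReal.comp (h.measurable_U d)) h1

theorem measurableSet_alive (hQP : Q ≪ P) (d : ℕ) :
    MeasurableSet[ℋ d] (alive Q P Z X U b d) := by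
  have : alive Q P Z X U b d = ⋂ j ∈ Set.Iio d, {ω | Accepts Q P Z X U b j ω}ᶜ := by
    ext ω; simp [alive]
  rw [this]
  refine MeasurableSet.biInter (Set.to_countable _) fun j hj => ?_
  exact (((h.mid_le j).trans (h.monotone_past hj)) _ (h.measurableSet_accepts hQP j)).compl

theorem measurableSet_alive_succ (hQP : Q ≪ P) (d : ℕ) :
    MeasurableSet[𝒢 d] (alive Q P Z X U b (d + 1)) := by
  rw [alive_succ]
  exact (h.le_mid d _ (h.measurableSet_alive hQP d)).inter (h.measurableSet_accepts hQP d).compl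

variable [IsProbabilityMeasure μ]

omit [IsProbabilityMeasure Q] in
theorem lintegral_draw (d : ℕ) {φ : Ω × 𝓧 × ℝ → ℝ≥0∞}
    (hφ : Measurable[(ℋ d).prod inferInstance] φ) :
    ∫⁻ ω in alive Q P Z X U b d, φ (ω, X d ω, U d ω) ∂μ =
      ∫⁻ ω in alive Q P Z X U b d, (P (activeSet Z b ω d))⁻¹ *
        ∫⁻ x in activeSet Z b ω d, (∫⁻ u in Set.Ioo (0 : ℝ) 1, φ (ω, x, u)) ∂P ∂μ := by
  -- The identity is viewed as a map onto `Ω` with the σ-algebra `ℋ d`, under `μ` restricted to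
  -- survival.
  refine GRC.lintegral_draw (mΩ' := ℋ d) (π := id) (s := fun ω => activeSet Z b ω d)
    (measurable_id'' (h.le_space d)) ((h.measurable_X d).mono (h.mid_le_space d) le_rfl)
    ((h.measurable_U d).mono (h.mid_le_space d) le_rfl) (h.measurableSet_active_prod d) ?_ hφ
  intro F hF B hB C hC
  have hF' := h.le_space d _ hF
  have hXU : MeasurableSet (X d ⁻¹' B ∩ U d ⁻¹' C) :=
    h.mid_le_space d _ ((h.measurable_X d hB).inter (h.measurable_U d hC))
  rw [Set.preimage_id, Measure.restrict_apply (hF'.inter hXU), Measure.restrict_restrict hF',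
    Set.inter_right_comm, h.law_draw d F hF B hB C hC]
  rfl

/-- The law of a rejection, given the past. -/
theorem setLIntegral_alive_succ (hQP : Q ≪ P) {d : ℕ}
    (hpos : ∀ᵐ ω ∂μ, ω ∈ alive Q P Z X U b d → residMass Q P (activeSet Z b ω) d ≠ 0)
    {g : Ω → ℝ≥0∞} (hg : Measurable[ℋ d] g) :
    ∫⁻ ω in alive Q P Z X U b (d + 1), g ω ∂μ =
      ∫⁻ ω in alive Q P Z X U b d, g ω * (rejMass Q P (activeSet Z b ω) d (activeSet Z b ω d) /
        residMass Q P (activeSet Z b ω) d) ∂μ := by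
  have hacc : MeasurableSet {ω | Accepts Q P Z X U b d ω} :=
    h.mid_le_space d _ (h.measurableSet_accepts hQP d)
  have hal : MeasurableSet (alive Q P Z X U b d) :=
    h.le_space d _ (h.measurableSet_alive hQP d)
  let R : Set (Ω × 𝓧 × ℝ) := {z | β Q P (activeSet Z b z.1) d z.2.1 < ENNReal.ofReal z.2.2}
  have hR : MeasurableSet[(ℋ d).prod inferInstance] R :=
    measurableSet_lt_ofReal (mΩ := ℋ d) (h.measurable_β_past hQP d)
  have hφ : Measurable[(ℋ d).prod inferInstance] (R.indicator fun z => g z.1) :=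
    (hg.comp (@measurable_fst _ _ (ℋ d) _)).indicator hR
  have key := h.lintegral_draw d hφ
  have hl : ∫⁻ ω in alive Q P Z X U b (d + 1), g ω ∂μ = ∫⁻ ω in alive Q P Z X U b d,
      R.indicator (fun z => g z.1) (ω, X d ω, U d ω) ∂μ := by
    rw [alive_succ, Set.inter_comm, ← Measure.restrict_restrict hacc.compl,
      ← lintegral_indicator hacc.compl]
    refine lintegral_congr fun ω => ?_
    simp [Set.indicator_apply, Accepts, R]
  rw [hl, key]
  refine setLIntegral_congr_fun_ae hal ?_
  filter_upwards [hpos] with ω hω hωal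
  rw [rejMass, ← inv_mul_setLIntegral_one_sub_β hQP (h.measurableSet_activeSet ω)
    (h.activeSet_zero ω) d (hω hωal), mul_left_comm]
  congr 1
  have hβ : Measurable fun x => 1 - β Q P (activeSet Z b ω) d x :=
    measurable_const.sub (measurable_β hQP (h.measurableSet_activeSet ω) d)
  rw [← lintegral_const_mul _ hβ]
  refine lintegral_congr fun x => ?_
  have hm : MeasurableSet {u : ℝ | β Q P (activeSet Z b ω) d x < ENNReal.ofReal u} :=
    measurableSet_lt measurable_const ENNReal.measurable_ofReal
  -- A uniform variable exceeds `β` with probability `1 - β`.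
  rw [← volume_lt_ofReal, ← Measure.restrict_apply hm, ← setLIntegral_const,
    ← lintegral_indicator hm]
  rfl

/-- The law of an accepted sample, given the past. -/
theorem measure_alive_accepts (hQP : Q ≪ P) {d : ℕ}
    (hpos : ∀ᵐ ω ∂μ, ω ∈ alive Q P Z X U b d → residMass Q P (activeSet Z b ω) d ≠ 0)
    {B : Set 𝓧} (hB : MeasurableSet B) :
    μ (alive Q P Z X U b d ∩ ({ω | Accepts Q P Z X U b d ω} ∩ X d ⁻¹' B)) =
      ∫⁻ ω in alive Q P Z X U b d,
        (∫⁻ x in B, min (resid Q P (activeSet Z b ω) d x) (level Q P (activeSet Z b ω) d) ∂P) /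
        residMass Q P (activeSet Z b ω) d ∂μ := by
  have hacc : MeasurableSet {ω | Accepts Q P Z X U b d ω} :=
    h.mid_le_space d _ (h.measurableSet_accepts hQP d)
  have hal : MeasurableSet (alive Q P Z X U b d) :=
    h.le_space d _ (h.measurableSet_alive hQP d)
  have hX : MeasurableSet (X d ⁻¹' B) := h.mid_le_space d _ (h.measurable_X d hB)
  let R : Set (Ω × 𝓧 × ℝ) :=
    {z | ENNReal.ofReal z.2.2 ≤ β Q P (activeSet Z b z.1) d z.2.1} ∩ {z | z.2.1 ∈ B}
  have hR : MeasurableSet[(ℋ d).prod inferInstance] R :=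
    measurableSet_ofReal_le_inter (mΩ := ℋ d) (h.measurable_β_past hQP d) hB
  have hφ : Measurable[(ℋ d).prod inferInstance] (R.indicator fun _ => (1 : ℝ≥0∞)) :=
    Measurable.indicator (@measurable_const _ _ _ ((ℋ d).prod _) 1) hR
  have key := h.lintegral_draw d hφ
  have hl : μ (alive Q P Z X U b d ∩ ({ω | Accepts Q P Z X U b d ω} ∩ X d ⁻¹' B)) =
      ∫⁻ ω in alive Q P Z X U b d, R.indicator (fun _ => 1) (ω, X d ω, U d ω) ∂μ := by
    rw [Set.inter_comm, ← Measure.restrict_apply (hacc.inter hX),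
      ← lintegral_indicator_one (hacc.inter hX)]
    rfl
  rw [hl, key]
  refine setLIntegral_congr_fun_ae hal ?_
  filter_upwards [hpos] with ω hω hωal
  rw [← inv_mul_setLIntegral_β hQP (h.measurableSet_activeSet ω)
    (h.activeSet_zero ω) d (hω hωal) hB]
  congr 1
  refine lintegral_congr fun x => ?_
  have hm : MeasurableSet {u : ℝ | ENNReal.ofReal u ≤ β Q P (activeSet Z b ω) d x} :=
    measurableSet_le ENNReal.measurable_ofReal measurable_const
  have hle := β_le_one hQP (h.measurableSet_activeSet ω) (h.activeSet_zero ω) (hω hωal) x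
  by_cases hx : x ∈ B
  · rw [Set.indicator_of_mem hx]
    conv_rhs => rw [← volume_ofReal_le hle, ← Measure.restrict_apply hm,
      ← lintegral_indicator_one hm]
    refine lintegral_congr fun u => ?_
    by_cases hu : ENNReal.ofReal u ≤ β Q P (activeSet Z b ω) d x <;> simp [R, hx, hu]
  · rw [Set.indicator_of_notMem hx]
    simp [R, hx]

end IsRun

end Run

/-! ### The law of the coin and the supermartingale -/

section Run

variable {Ω 𝓧 : Type*} [mΩ : MeasurableSpace Ω] [MeasurableSpace 𝓧]
  {μ : Measure Ω} {Q P : Measure 𝓧} {Z : ℕ → Ω → Set 𝓧} {X : ℕ → Ω → 𝓧} {U : ℕ → Ω → ℝ}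
  {b : ℕ → Ω → Bool} {ℋ 𝒢 : ℕ → MeasurableSpace Ω}

namespace IsRun

variable (h : IsRun μ Q P Z X U b ℋ 𝒢)
include h

theorem rejMass_children (ω : Ω) (d : ℕ) :
    rejMass Q P (activeSet Z b ω) d (Z (2 * node b ω d + true.toNat) ω) +
      rejMass Q P (activeSet Z b ω) d (Z (2 * node b ω d + false.toNat) ω) =
    rejMass Q P (activeSet Z b ω) d (activeSet Z b ω d) :=
  h.setLIntegral_children ω d _

theorem setLIntegral_alive_bool (d : ℕ) (g : Ω → ℝ≥0∞) :
    ∫⁻ ω in alive Q P Z X U b (d + 1), g ω ∂μ =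
      ∫⁻ ω in alive Q P Z X U b (d + 1) ∩ {ω | b d ω = true}, g ω ∂μ +
        ∫⁻ ω in alive Q P Z X U b (d + 1) ∩ {ω | b d ω = false}, g ω ∂μ := by
  have hb : MeasurableSet {ω | b d ω = true} :=
    h.le_space _ _ (h.measurable_b d (measurableSet_singleton true))
  rw [← lintegral_inter_add_sdiff g _ hb]
  congr 3
  ext ω; simp

theorem residMass_succ_eq (ω : Ω) (d : ℕ) : residMass Q P (activeSet Z b ω) (d + 1) =
    rejMass Q P (activeSet Z b ω) d (Z (2 * node b ω d + (b d ω).toNat) ω) :=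
  residMass_succ (h.measurableSet_activeSet ω) d

variable [IsProbabilityMeasure P]

theorem measurable_rejMass_active (d : ℕ) :
    Measurable[ℋ d] fun ω => rejMass Q P (activeSet Z b ω) d (activeSet Z b ω d) :=
  measurable_setLIntegral (mΩ := ℋ d) (h.measurableSet_active_prod d)
    (h.measurable_resid_sub_level d)

theorem measurable_setLIntegral_child (d : ℕ) (c : Bool) {n : Ω → 𝓧 → ℝ≥0∞}
    (hn : Measurable[(ℋ d).prod inferInstance] (Function.uncurry n)) :
    Measurable[𝒢 d] fun ω => ∫⁻ x in Z (2 * node b ω d + c.toNat) ω, n ω x ∂P :=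
  measurable_setLIntegral (mΩ := 𝒢 d) (h.measurable_children d c)
    (hn.mono (h.prod_past_le_mid d) le_rfl)

theorem measurable_rejMass_child (d : ℕ) (c : Bool) :
    Measurable[𝒢 d]
      fun ω => rejMass Q P (activeSet Z b ω) d (Z (2 * node b ω d + c.toNat) ω) :=
  h.measurable_setLIntegral_child d c (h.measurable_resid_sub_level d)

variable [IsProbabilityMeasure Q]

theorem measurableSet_alive_bool (hQP : Q ≪ P) (d : ℕ) (c : Bool) :
    MeasurableSet (alive Q P Z X U b (d + 1) ∩ {ω | b d ω = c}) :=
  (h.mid_le_space d _ (h.measurableSet_alive_succ hQP d)).inter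
    (h.le_space _ _ (h.measurable_b d (measurableSet_singleton c)))

variable [IsProbabilityMeasure μ]

/-- The rejection probability is proportional to `rejMass`, so testing the rejection law on the
event where `rejMass` vanishes gives that event, within survival, measure zero. -/
theorem rejMass_active_ne_zero (hQP : Q ≪ P) {d : ℕ}
    (hpos : ∀ᵐ ω ∂μ, ω ∈ alive Q P Z X U b d → residMass Q P (activeSet Z b ω) d ≠ 0) :
    ∀ᵐ ω ∂μ, ω ∈ alive Q P Z X U b (d + 1) →
      rejMass Q P (activeSet Z b ω) d (activeSet Z b ω d) ≠ 0 := by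
  have hm := h.measurable_rejMass_active d
  let N : Set Ω := {ω | rejMass Q P (activeSet Z b ω) d (activeSet Z b ω d) = 0}
  have hN : MeasurableSet[ℋ d] N := hm (measurableSet_singleton 0)
  have hN' := h.le_space d _ hN
  have h1 := h.setLIntegral_alive_succ hQP hpos
    (g := N.indicator fun _ => 1) ((@measurable_const _ _ _ (ℋ d) 1).indicator hN)
  have h2 : ∀ ω, N.indicator (fun _ => (1 : ℝ≥0∞)) ω *
      (rejMass Q P (activeSet Z b ω) d (activeSet Z b ω d) /
        residMass Q P (activeSet Z b ω) d) = 0 := by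
    intro ω
    by_cases hω : ω ∈ N
    · rw [show rejMass Q P (activeSet Z b ω) d (activeSet Z b ω d) = 0 from hω]; simp
    · simp [hω]
  simp_rw [h2] at h1
  rw [lintegral_indicator hN', setLIntegral_one, Measure.restrict_apply hN', lintegral_zero] at h1
  rw [ae_iff]
  refine measure_mono_null ?_ h1
  intro ω hω
  simp only [Set.mem_ofPred_eq, Classical.not_imp, not_not] at hω
  exact ⟨hω.2, hω.1⟩

/-- The law of the coin, given the past and a rejection. -/
theorem setLIntegral_coin (hQP : Q ≪ P) {d : ℕ}
    (hrej : ∀ᵐ ω ∂μ, ω ∈ alive Q P Z X U b (d + 1) →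
      rejMass Q P (activeSet Z b ω) d (activeSet Z b ω d) ≠ 0) (c : Bool)
    {g : Ω → ℝ≥0∞} (hg : Measurable[𝒢 d] g) :
    ∫⁻ ω in alive Q P Z X U b (d + 1) ∩ {ω | b d ω = c}, g ω ∂μ =
      ∫⁻ ω in alive Q P Z X U b (d + 1), rejMass Q P (activeSet Z b ω) d (Z (2 * node b ω d + c.toNat) ω) /
          rejMass Q P (activeSet Z b ω) d (activeSet Z b ω d) * g ω ∂μ := by
  have hal := h.mid_le_space d _ (h.measurableSet_alive_succ hQP d)
  have hb : ∀ c, MeasurableSet {ω | b d ω = c} := fun c =>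
    h.le_space _ _ (h.measurable_b d (measurableSet_singleton c))
  have hp : ∀ c : Bool, Measurable[𝒢 d] fun ω =>
      rejMass Q P (activeSet Z b ω) d (Z (2 * node b ω d + c.toNat) ω) /
        rejMass Q P (activeSet Z b ω) d (activeSet Z b ω d) := fun c =>
    (h.measurable_rejMass_child d c).div ((h.measurable_rejMass_active d).mono (h.le_mid d) le_rfl)
  have htrue : ∀ F, MeasurableSet[𝒢 d] F → μ (F ∩ alive Q P Z X U b (d + 1) ∩ {ω | b d ω = true}) =
      ∫⁻ ω in F ∩ alive Q P Z X U b (d + 1),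
        rejMass Q P (activeSet Z b ω) d (Z (2 * node b ω d + true.toNat) ω) /
          rejMass Q P (activeSet Z b ω) d (activeSet Z b ω d) ∂μ := by
    intro F hF
    rw [h.law_coin d F hF]
    refine lintegral_congr fun ω => ?_
    exact branchProb_eq hQP (h.measurableSet_activeSet ω) d (h.measurableSet_child ω d true)
  have hall : ∀ F, MeasurableSet[𝒢 d] F → μ (F ∩ alive Q P Z X U b (d + 1) ∩ {ω | b d ω = c}) =
      ∫⁻ ω in F ∩ alive Q P Z X U b (d + 1),
        rejMass Q P (activeSet Z b ω) d (Z (2 * node b ω d + c.toNat) ω) /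
          rejMass Q P (activeSet Z b ω) d (activeSet Z b ω d) ∂μ := by
    intro F hF
    cases c with
    | true => exact htrue F hF
    | false =>
      -- The law of tails follows by complement: the shares of the two children sum to one, as the
      -- mass they divide is nonzero.
      have hFa := (h.mid_le_space d _ hF).inter hal
      have hsum : ∫⁻ ω in F ∩ alive Q P Z X U b (d + 1),
          rejMass Q P (activeSet Z b ω) d (Z (2 * node b ω d + true.toNat) ω) /
            rejMass Q P (activeSet Z b ω) d (activeSet Z b ω d) ∂μ +
          ∫⁻ ω in F ∩ alive Q P Z X U b (d + 1),
          rejMass Q P (activeSet Z b ω) d (Z (2 * node b ω d + false.toNat) ω) /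
            rejMass Q P (activeSet Z b ω) d (activeSet Z b ω d) ∂μ =
          μ (F ∩ alive Q P Z X U b (d + 1)) := by
        rw [← lintegral_add_left ((hp true).mono (h.mid_le_space d) le_rfl), ← setLIntegral_one]
        refine setLIntegral_congr_fun_ae hFa ?_
        filter_upwards [hrej] with ω hω hωF
        rw [← ENNReal.add_div, h.rejMass_children,
          ENNReal.div_self (hω hωF.2) (rejMass_ne_top hQP d _)]
      have hsplit := measure_inter_add_sdiff (μ := μ) (F ∩ alive Q P Z X U b (d + 1)) (hb true)
      have hd : (F ∩ alive Q P Z X U b (d + 1)) \ {ω | b d ω = true} =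
          F ∩ alive Q P Z X U b (d + 1) ∩ {ω | b d ω = false} := by
        ext ω; simp
      rw [hd, ← hsum, htrue F hF] at hsplit
      refine (ENNReal.add_right_inj ?_).1 hsplit
      rw [← htrue F hF]; exact measure_ne_top _ _
  refine lintegral_of_setLIntegral (mΩ' := 𝒢 d) (π := id) (measurable_id'' (h.mid_le_space d))
    (hp c) ?_ hg
  intro F hF
  have hF' := h.mid_le_space d _ hF
  rw [Set.preimage_id, Measure.restrict_apply hF', Measure.restrict_restrict hF', ← Set.inter_assoc,
    hall F hF]
  rfl

/-- While the algorithm runs, some mass of `Q` is not accounted for. -/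
theorem residMass_ne_zero (hQP : Q ≪ P) (d : ℕ) :
    ∀ᵐ ω ∂μ, ω ∈ alive Q P Z X U b d → residMass Q P (activeSet Z b ω) d ≠ 0 := by
  induction d with
  | zero =>
    refine Eventually.of_forall fun ω _ => ?_
    have : residMass Q P (activeSet Z b ω) 0 = 1 := by
      rw [residMass, resid, Measure.lintegral_rnDeriv hQP, measure_univ]
    simp [this]
  | succ d ih =>
    -- Positivity at time `d` validates the rejection and coin laws of step `d`; these give
    -- positivity at time `d + 1`.
    have hrej := h.rejMass_active_ne_zero hQP ih
    -- A child with no mass left is chosen with probability zero.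
    have hc : ∀ c, ∀ᵐ ω ∂μ, ω ∈ alive Q P Z X U b (d + 1) ∩ {ω | b d ω = c} →
        rejMass Q P (activeSet Z b ω) d (Z (2 * node b ω d + c.toNat) ω) ≠ 0 := by
      intro c
      let N : Set Ω := {ω | rejMass Q P (activeSet Z b ω) d (Z (2 * node b ω d + c.toNat) ω) = 0}
      have hN : MeasurableSet[𝒢 d] N := h.measurable_rejMass_child d c (measurableSet_singleton 0)
      have hN' := h.mid_le_space d _ hN
      have h1 := h.setLIntegral_coin hQP hrej c
        (g := N.indicator fun _ => 1) ((@measurable_const _ _ _ (𝒢 d) 1).indicator hN)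
      have h2 : ∀ ω, rejMass Q P (activeSet Z b ω) d (Z (2 * node b ω d + c.toNat) ω) /
          rejMass Q P (activeSet Z b ω) d (activeSet Z b ω d) *
            N.indicator (fun _ => (1 : ℝ≥0∞)) ω = 0 := by
        intro ω
        by_cases hω : ω ∈ N
        · rw [show rejMass Q P (activeSet Z b ω) d (Z (2 * node b ω d + c.toNat) ω) = 0 from hω]
          simp
        · simp [hω]
      simp_rw [h2] at h1
      rw [lintegral_indicator hN', setLIntegral_one, Measure.restrict_apply hN',
        lintegral_zero] at h1
      rw [ae_iff]
      refine measure_mono_null ?_ h1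
      intro ω hω
      simp only [Set.mem_ofPred_eq, Classical.not_imp, not_not] at hω
      exact ⟨hω.2, hω.1⟩
    filter_upwards [hc true, hc false] with ω h1 h2 hω
    rw [h.residMass_succ_eq]
    cases hb : b d ω with
    | true => exact h1 ⟨hω, hb⟩
    | false => exact h2 ⟨hω, hb⟩

/-- Mass of the active set relative to the mass of `Q` that is not accounted for is a
supermartingale. -/
theorem setLIntegral_ratio_succ_le (hQP : Q ≪ P) (d : ℕ) {n : Ω → 𝓧 → ℝ≥0∞}
    (hn : Measurable[(ℋ d).prod inferInstance] (Function.uncurry n)) :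
    ∫⁻ ω in alive Q P Z X U b (d + 1), (∫⁻ x in activeSet Z b ω (d + 1), n ω x ∂P) /
        residMass Q P (activeSet Z b ω) (d + 1) ∂μ ≤
      ∫⁻ ω in alive Q P Z X U b d, (∫⁻ x in activeSet Z b ω d, n ω x ∂P) /
        residMass Q P (activeSet Z b ω) d ∂μ := by
  have hpos := h.residMass_ne_zero hQP d
  have hrej := h.rejMass_active_ne_zero hQP hpos
  -- Only an inequality: for `a = 0` or `a = ∞` the left side is zero.
  have hcancel : ∀ a r m : ℝ≥0∞, a / r * (m / a) ≤ m / r := by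
    intro a r m
    calc a / r * (m / a) = a * a⁻¹ * (m / r) := by simp only [div_eq_mul_inv]; ring
      _ ≤ 1 * (m / r) := by gcongr; exact ENNReal.mul_inv_le_one a
      _ = _ := one_mul _
  -- The numerator of the coin probability cancels the new residual mass, leaving `rejMass` of the
  -- parent as denominator.
  have hchild : ∀ c, ∫⁻ ω in alive Q P Z X U b (d + 1) ∩ {ω | b d ω = c},
      (∫⁻ x in activeSet Z b ω (d + 1), n ω x ∂P) /
        residMass Q P (activeSet Z b ω) (d + 1) ∂μ ≤
      ∫⁻ ω in alive Q P Z X U b (d + 1), (∫⁻ x in Z (2 * node b ω d + c.toNat) ω, n ω x ∂P) /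
        rejMass Q P (activeSet Z b ω) d (activeSet Z b ω d) ∂μ := by
    intro c
    have hm := (h.measurable_setLIntegral_child d c hn).div (h.measurable_rejMass_child d c)
    refine le_trans (le_of_eq ?_) ((h.setLIntegral_coin hQP hrej c hm).le.trans
      (lintegral_mono fun ω => hcancel _ _ _))
    refine setLIntegral_congr_fun (h.measurableSet_alive_bool hQP d c) fun ω hω => ?_
    have hb : b d ω = c := hω.2
    rw [h.residMass_succ_eq, activeSet_succ, hb]
    rfl
  have hactive : Measurable[ℋ d] fun ω => (∫⁻ x in activeSet Z b ω d, n ω x ∂P) /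
      rejMass Q P (activeSet Z b ω) d (activeSet Z b ω d) :=
    (measurable_setLIntegral (mΩ := ℋ d) (h.measurableSet_active_prod d) hn).div
      (h.measurable_rejMass_active d)
  have hmeas : Measurable fun ω => (∫⁻ x in Z (2 * node b ω d + true.toNat) ω, n ω x ∂P) /
      rejMass Q P (activeSet Z b ω) d (activeSet Z b ω d) :=
    ((h.measurable_setLIntegral_child d true hn).mono (h.mid_le_space d) le_rfl).div
      ((h.measurable_rejMass_active d).mono (h.le_space d) le_rfl)
  rw [h.setLIntegral_alive_bool]
  refine (add_le_add (hchild true) (hchild false)).trans ?_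
  rw [← lintegral_add_left hmeas]
  -- The children add up to the active set; the rejection probability then replaces `rejMass` of the
  -- parent by `residMass`.
  simp_rw [← ENNReal.add_div, h.setLIntegral_children]
  rw [h.setLIntegral_alive_succ hQP hpos hactive]
  refine lintegral_mono fun ω => ?_
  rw [mul_comm]
  calc _ = rejMass Q P (activeSet Z b ω) d (activeSet Z b ω d) /
          residMass Q P (activeSet Z b ω) d *
        ((∫⁻ x in activeSet Z b ω d, n ω x ∂P) /
          rejMass Q P (activeSet Z b ω) d (activeSet Z b ω d)) := rfl
    _ ≤ _ := hcancel _ _ _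

end IsRun

end Run

/-! ### Termination and the law of the returned sample -/

section Run

variable {Ω 𝓧 : Type*} [mΩ : MeasurableSpace Ω] [MeasurableSpace 𝓧]
  {μ : Measure Ω} {Q P : Measure 𝓧} {Z : ℕ → Ω → Set 𝓧} {X : ℕ → Ω → 𝓧} {U : ℕ → Ω → ℝ}
  {b : ℕ → Ω → Bool} {ℋ 𝒢 : ℕ → MeasurableSpace Ω}

omit mΩ in
theorem stopIndex_eq {d : ℕ} {ω : Ω} (hd : ω ∈ alive Q P Z X U b d)
    (ha : Accepts Q P Z X U b d ω) : stopIndex Q P Z X U b ω = d := by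
  refine le_antisymm (Nat.sInf_le ha) (not_lt.1 fun hlt => ?_)
  exact hd _ hlt (Nat.sInf_mem (s := {d | Accepts Q P Z X U b d ω}) ⟨d, ha⟩)

omit mΩ in
theorem antitone_alive : Antitone (alive Q P Z X U b) :=
  fun _ _ hij _ hω k hk => hω k (hk.trans_le hij)

omit mΩ in
theorem compl_alive_succ_inter_returned (d : ℕ) (B : Set 𝓧) :
    (alive Q P Z X U b (d + 1))ᶜ ∩ returned Q P Z X U b ⁻¹' B ⊆
      ((alive Q P Z X U b d)ᶜ ∩ returned Q P Z X U b ⁻¹' B) ∪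
        (alive Q P Z X U b d ∩ ({ω | Accepts Q P Z X U b d ω} ∩ X d ⁻¹' B)) := by
  rintro ω ⟨h1, h2⟩
  by_cases hω : ω ∈ alive Q P Z X U b d
  · have ha : Accepts Q P Z X U b d ω := by
      by_contra ha
      exact h1 (by rw [alive_succ]; exact ⟨hω, ha⟩)
    refine Or.inr ⟨hω, ha, ?_⟩
    rwa [Set.mem_preimage, returned, stopIndex_eq hω ha] at h2
  · exact Or.inl ⟨hω, h2⟩

/-- The mass of `Q` on the points at which `dQ/dP` is large tends to zero. -/
theorem tendsto_measure_rnDeriv_gt [SigmaFinite Q] [IsFiniteMeasure Q] (hQP : Q ≪ P) :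
    Tendsto (fun M : ℕ => Q {x | (M : ℝ≥0∞) < Q.rnDeriv P x}) atTop (𝓝 0) := by
  have hm := Q.measurable_rnDeriv P
  -- The intersection is `{dQ/dP = ∞}`, which is null for `P`, hence for `Q`.
  have h0 : Q (⋂ M : ℕ, {x | (M : ℝ≥0∞) < Q.rnDeriv P x}) = 0 := by
    refine hQP ?_
    refine measure_mono_null ?_ (ae_iff.1 (Q.rnDeriv_lt_top P))
    intro x hx hlt
    obtain ⟨n, hn⟩ := ENNReal.exists_nat_gt hlt.ne
    exact lt_asymm hn (Set.mem_iInter.1 hx n)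
  rw [← h0]
  refine tendsto_measure_iInter_atTop
    (fun M => (measurableSet_lt measurable_const hm).nullMeasurableSet) ?_ ⟨0, measure_ne_top _ _⟩
  intro M N hMN x hx
  have hx' : (N : ℝ≥0∞) < Q.rnDeriv P x := hx
  exact lt_of_le_of_lt (Nat.cast_le.2 hMN) hx'

variable [IsProbabilityMeasure P] [IsProbabilityMeasure Q]

namespace IsRun

variable (h : IsRun μ Q P Z X U b ℋ 𝒢)
include h

theorem measurable_returned (hQP : Q ≪ P) : Measurable (returned Q P Z X U b) := by
  have hal : ∀ n, MeasurableSet (alive Q P Z X U b n) := fun n =>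
    h.le_space n _ (h.measurableSet_alive hQP n)
  have h_index : Measurable (stopIndex Q P Z X U b) := by
    refine measurable_of_Iic fun n => ?_
    -- Runs that never accept are included, because there `sInf ∅ = 0`.
    have : stopIndex Q P Z X U b ⁻¹' Set.Iic n =
        (alive Q P Z X U b (n + 1))ᶜ ∪ ⋂ k, alive Q P Z X U b k := by
      ext ω
      simp only [Set.mem_preimage, Set.mem_Iic, Set.mem_union, Set.mem_compl_iff, Set.mem_iInter]
      constructor
      · intro hn
        by_contra! hcon
        obtain ⟨h1, k, hk⟩ := hcon
        have hne : {d | Accepts Q P Z X U b d ω}.Nonempty := by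
          by_contra! he
          exact hk fun j _ hj => Set.notMem_empty j (he ▸ hj)
        exact h1 _ (Nat.lt_succ_of_le hn) (Nat.sInf_mem hne)
      · rintro (h1 | h1)
        · simp only [alive, Set.mem_ofPred_eq, not_forall, not_not] at h1
          obtain ⟨j, hj, ha⟩ := h1
          exact (Nat.sInf_le (s := {d | Accepts Q P Z X U b d ω}) ha).trans (Nat.le_of_lt_succ hj)
        · have : {d | Accepts Q P Z X U b d ω} = ∅ :=
            Set.eq_empty_of_forall_notMem fun d hd => h1 (d + 1) d d.lt_succ_self hd
          simp [stopIndex, this]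
    rw [this]
    exact (hal _).compl.union (MeasurableSet.iInter hal)
  have hX : Measurable fun p : ℕ × Ω => X p.1 p.2 :=
    measurable_from_prod_countable_right fun n => (h.measurable_X n).mono (h.mid_le_space n) le_rfl
  exact hX.comp (h_index.prodMk measurable_id)

theorem τ_apply (hQP : Q ≪ P) (d : ℕ) {B : Set 𝓧} (hB : MeasurableSet B) :
    τ μ Q P Z X U b d B = μ ((alive Q P Z X U b d)ᶜ ∩ returned Q P Z X U b ⁻¹' B) := by
  have hr := h.measurable_returned hQP
  rw [τ, Measure.map_apply hr hB, Measure.restrict_apply (hr hB), Set.inter_comm]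

theorem measurableSet_alive_inter_sum_lt (hQP : Q ≪ P) (M : ℝ≥0∞) (d : ℕ) :
    MeasurableSet (alive Q P Z X U b d ∩
      {ω | ∑ j ∈ Finset.range d, level Q P (activeSet Z b ω) j < M}) := by
  refine (h.le_space d _ (h.measurableSet_alive hQP d)).inter
    (measurableSet_lt (Finset.measurable_sum _ fun j _ => ?_) measurable_const)
  exact (h.measurable_level_past j).mono (h.le_space j) le_rfl

theorem measure_returned_le (hQP : Q ≪ P) (d : ℕ) {B : Set 𝓧} (hB : MeasurableSet B) :
    μ (returned Q P Z X U b ⁻¹' B) ≤ τ μ Q P Z X U b d B + μ (alive Q P Z X U b d) := by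
  rw [h.τ_apply hQP d hB]
  refine (measure_mono fun ω hω => ?_).trans (measure_union_le _ _)
  by_cases ha : ω ∈ alive Q P Z X U b d
  exacts [Or.inr ha, Or.inl ⟨ha, hω⟩]

variable [IsProbabilityMeasure μ]

/-- The left side equals `Q B` at `d = 0` and cannot increase: `r = min(r, l) + (r - l)⁺` splits the
share of `B` into what step `d` accepts and what it leaves, and the latter is controlled by the
supermartingale. -/
theorem measure_returned_add_le (hQP : Q ≪ P) (d : ℕ) {B : Set 𝓧} (hB : MeasurableSet B) :
    μ ((alive Q P Z X U b d)ᶜ ∩ returned Q P Z X U b ⁻¹' B) +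
      ∫⁻ ω in alive Q P Z X U b d, (∫⁻ x in B, resid Q P (activeSet Z b ω) d x ∂P) /
        residMass Q P (activeSet Z b ω) d ∂μ ≤ Q B := by
  induction d with
  | zero =>
    have h0 : alive Q P Z X U b 0 = Set.univ := by ext ω; simp [alive]
    simp [h0, residMass, resid, Measure.lintegral_rnDeriv hQP, Measure.setLIntegral_rnDeriv hQP]
  | succ d ih =>
    refine le_trans ?_ ih
    have hpos := h.residMass_ne_zero hQP d
    -- The next residual on `B` before it is cut to a child, hence known before the draw.
    let n : Ω → 𝓧 → ℝ≥0∞ := fun ω => B.indicator fun x =>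
      resid Q P (activeSet Z b ω) d x - level Q P (activeSet Z b ω) d
    have hn : Measurable[(ℋ d).prod inferInstance] (Function.uncurry n) :=
      (h.measurable_resid_sub_level d).indicator ((@measurable_snd _ _ (ℋ d) _) hB)
    have h1 := h.setLIntegral_ratio_succ_le hQP d hn
    have h2 : ∀ ω, ∫⁻ x in B, resid Q P (activeSet Z b ω) (d + 1) x ∂P =
        ∫⁻ x in activeSet Z b ω (d + 1), n ω x ∂P := by
      intro ω
      rw [setLIntegral_indicator hB, resid_succ,
        setLIntegral_indicator (h.measurableSet_activeSet ω _), Set.inter_comm]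
    have hmin : Measurable fun ω => (∫⁻ x in B, min (resid Q P (activeSet Z b ω) d x)
        (level Q P (activeSet Z b ω) d) ∂P) / residMass Q P (activeSet Z b ω) d := by
      refine Measurable.mono (Measurable.div ?_ (h.measurable_residMass_past d)) (h.le_space d)
        le_rfl
      refine measurable_setLIntegral (mΩ := ℋ d) (s := fun _ => B)
        ((@measurable_snd _ _ (ℋ d) _) hB) ?_
      exact (h.measurable_resid_past d).min
        ((h.measurable_level_past d).comp (@measurable_fst _ _ (ℋ d) _))
    simp_rw [h2]
    refine (add_le_add ((measure_mono (compl_alive_succ_inter_returned d B)).trans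
      (measure_union_le _ _)) h1).trans ?_
    rw [add_assoc, h.measure_alive_accepts hQP hpos hB, ← lintegral_add_left hmin]
    gcongr with ω
    rw [← ENNReal.add_div]
    gcongr
    have hres := measurable_resid (Q := Q) (P := P) (h.measurableSet_activeSet ω) d
    calc _ ≤ (∫⁻ x in B, min (resid Q P (activeSet Z b ω) d x)
          (level Q P (activeSet Z b ω) d) ∂P) + ∫⁻ x in B, (resid Q P (activeSet Z b ω) d x -
            level Q P (activeSet Z b ω) d) ∂P := by
          refine add_le_add_right ?_ _
          rw [setLIntegral_indicator hB]
          exact lintegral_mono_set Set.inter_subset_left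
      _ = _ := by
          rw [← lintegral_add_left (hres.min measurable_const)]
          refine lintegral_congr fun x => ?_
          rcases le_total (resid Q P (activeSet Z b ω) d x) (level Q P (activeSet Z b ω) d)
            with hle | hle
          · rw [min_eq_left hle, tsub_eq_zero_of_le hle, add_zero]
          · rw [min_eq_right hle, add_tsub_cancel_of_le hle]

theorem τ_le (hQP : Q ≪ P) (d : ℕ) {B : Set 𝓧} (hB : MeasurableSet B) :
    τ μ Q P Z X U b d B ≤ Q B := by
  rw [h.τ_apply hQP d hB]
  exact le_self_add.trans (h.measure_returned_add_le hQP d hB)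

/-- The supermartingale with `n = 1`, which starts at `1`; the integrand is the reciprocal of the
level. -/
theorem setLIntegral_measure_active_le_one (hQP : Q ≪ P) (d : ℕ) :
    ∫⁻ ω in alive Q P Z X U b d, P (activeSet Z b ω d) / residMass Q P (activeSet Z b ω) d ∂μ
      ≤ 1 := by
  induction d with
  | zero =>
    have h0 : alive Q P Z X U b 0 = Set.univ := by ext ω; simp [alive]
    simp [h0, h.activeSet_zero, residMass, resid, Measure.lintegral_rnDeriv hQP]
  | succ d ih =>
    refine le_trans ?_ ih
    have h1 := h.setLIntegral_ratio_succ_le hQP d (n := fun _ _ => 1)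
      (@measurable_const _ _ _ ((ℋ d).prod _) 1)
    simpa using h1

/-- A run along which the levels are summable terminates almost surely. -/
theorem measure_iInter_alive_inter_sum_lt (hQP : Q ≪ P) {M : ℝ≥0∞} (hM : M ≠ ∞) :
    μ (⋂ d, alive Q P Z X U b d ∩
      {ω | ∑ j ∈ Finset.range d, level Q P (activeSet Z b ω) j < M}) = 0 := by
  set D : Set Ω := ⋂ d, alive Q P Z X U b d ∩
      {ω | ∑ j ∈ Finset.range d, level Q P (activeSet Z b ω) j < M} with hD
  have hDm : MeasurableSet D :=
    MeasurableSet.iInter fun d => h.measurableSet_alive_inter_sum_lt hQP M d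
  have hV : ∀ d, Measurable fun ω =>
      P (activeSet Z b ω d) / residMass Q P (activeSet Z b ω) d := fun d =>
    ((measurable_measure_active (mΩ := ℋ d) (h.measurableSet_active_prod d)).div
      (h.measurable_residMass_past d)).mono (h.le_space d) le_rfl
  -- Fatou's lemma, with the uniform bound `1` on the integrals.
  have h1 : ∫⁻ ω in D, liminf (fun d =>
      P (activeSet Z b ω d) / residMass Q P (activeSet Z b ω) d) atTop ∂μ ≤ 1 := by
    refine (lintegral_liminf_le hV).trans ?_
    refine liminf_le_of_le (by isBoundedDefault) fun c hc => ?_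
    obtain ⟨d, hd⟩ := hc.exists
    refine hd.trans ((lintegral_mono_set ?_).trans (h.setLIntegral_measure_active_le_one hQP d))
    exact (Set.iInter_subset _ d).trans Set.inter_subset_left
  -- On `D` the levels are summable, so they tend to zero and their reciprocals to infinity.
  have h2 : ∫⁻ ω in D, liminf (fun d =>
      P (activeSet Z b ω d) / residMass Q P (activeSet Z b ω) d) atTop ∂μ = ∫⁻ ω in D, ∞ ∂μ := by
    refine setLIntegral_congr_fun_ae hDm ?_
    filter_upwards [ae_all_iff.2 fun d => h.residMass_ne_zero hQP d] with ω hω hωD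
    have hωD' := Set.mem_iInter.1 hωD
    have hsum : ∑' j, level Q P (activeSet Z b ω) j ≠ ∞ := by
      refine ne_top_of_le_ne_top hM ?_
      refine ENNReal.tsum_le_of_sum_range_le fun d => (hωD' d).2.le
    have h0 := ENNReal.tendsto_atTop_zero_of_tsum_ne_top hsum
    have hinv := (tendsto_inv_iff.2 h0)
    rw [ENNReal.inv_zero] at hinv
    refine Tendsto.liminf_eq (hinv.congr fun d => ?_)
    rw [level, ENNReal.inv_div (Or.inl (measure_ne_top _ _)) (Or.inr (hω d (hωD' d).1))]
  rw [h2, setLIntegral_const] at h1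
  by_contra hne
  rw [ENNReal.top_mul hne] at h1
  exact absurd h1 (by simp)

/-- On survival the shares of the residual on `B = {dQ/dP > M}` and on its complement sum to one.
The first has expectation at most `Q B`; the second vanishes once the levels sum to at least `M`,
and is at most one before. -/
theorem measure_alive_le (hQP : Q ≪ P) (d : ℕ) (M : ℝ≥0∞) :
    μ (alive Q P Z X U b d) ≤ Q {x | M < Q.rnDeriv P x} + μ (alive Q P Z X U b d ∩
      {ω | ∑ j ∈ Finset.range d, level Q P (activeSet Z b ω) j < M}) := by
  have hal : MeasurableSet (alive Q P Z X U b d) := h.le_space d _ (h.measurableSet_alive hQP d)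
  set B : Set 𝓧 := {x | M < Q.rnDeriv P x} with hBdef
  have hB : MeasurableSet B := measurableSet_lt measurable_const (Q.measurable_rnDeriv P)
  set C : Set Ω := {ω | ∑ j ∈ Finset.range d, level Q P (activeSet Z b ω) j < M} with hCdef
  have hC := h.measurableSet_alive_inter_sum_lt hQP M d
  have hm : Measurable fun ω => (∫⁻ x in B, resid Q P (activeSet Z b ω) d x ∂P) /
      residMass Q P (activeSet Z b ω) d :=
    ((measurable_setLIntegral (mΩ := ℋ d) (s := fun _ => B)
      (n := fun ω => resid Q P (activeSet Z b ω) d)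
      ((@measurable_snd _ _ (ℋ d) _) hB) (h.measurable_resid_past d)).div
      (h.measurable_residMass_past d)).mono (h.le_space d) le_rfl
  have h1 : μ (alive Q P Z X U b d) = ∫⁻ ω in alive Q P Z X U b d,
      ((∫⁻ x in B, resid Q P (activeSet Z b ω) d x ∂P) / residMass Q P (activeSet Z b ω) d +
        (∫⁻ x in Bᶜ, resid Q P (activeSet Z b ω) d x ∂P) /
          residMass Q P (activeSet Z b ω) d) ∂μ := by
    rw [← setLIntegral_one]
    refine setLIntegral_congr_fun_ae hal ?_
    filter_upwards [h.residMass_ne_zero hQP d] with ω hω hωal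
    rw [← ENNReal.add_div, lintegral_add_compl _ hB]
    exact (ENNReal.div_self (hω hωal) (residMass_ne_top hQP d)).symm
  rw [h1, lintegral_add_left hm]
  refine add_le_add (le_add_self.trans (h.measure_returned_add_le hQP d hB)) ?_
  rw [← lintegral_indicator_one hC, ← lintegral_indicator hal]
  refine lintegral_mono fun ω => ?_
  by_cases hω : ω ∈ alive Q P Z X U b d
  · rw [Set.indicator_of_mem hω]
    by_cases hωC : ω ∈ C
    · rw [Set.indicator_of_mem (Set.mem_inter hω hωC)]
      refine ENNReal.div_le_of_le_mul ?_
      rw [Pi.one_apply, one_mul]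
      exact setLIntegral_le_lintegral _ _
    · have hz : ∫⁻ x in Bᶜ, resid Q P (activeSet Z b ω) d x ∂P = 0 := by
        rw [setLIntegral_congr_fun (g := fun _ => 0) hB.compl, lintegral_zero]
        intro x hx
        have hx' : Q.rnDeriv P x ≤ M := not_lt.1 hx
        have hωC' : M ≤ ∑ j ∈ Finset.range d, level Q P (activeSet Z b ω) j := not_lt.1 hωC
        refine le_antisymm ((resid_le_rnDeriv_sub_sum d x).trans ?_) zero_le
        rw [tsub_eq_zero_of_le (hx'.trans hωC')]
      rw [hz, ENNReal.zero_div]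
      exact zero_le
  · rw [Set.indicator_of_notMem hω]
    exact zero_le

/-- Greedy rejection coding terminates almost surely. -/
theorem measure_iInter_alive (hQP : Q ≪ P) : μ (⋂ d, alive Q P Z X U b d) = 0 := by
  -- Let `d → ∞` for fixed `M`, and only then `M → ∞`.
  have h1 : ∀ M : ℕ, μ (⋂ d, alive Q P Z X U b d) ≤ Q {x | (M : ℝ≥0∞) < Q.rnDeriv P x} := by
    intro M
    have hanti : Antitone fun d => alive Q P Z X U b d ∩
        {ω | ∑ j ∈ Finset.range d, level Q P (activeSet Z b ω) j < M} := by
      intro i j hij ω hω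
      have hω2 : ∑ j ∈ Finset.range j, level Q P (activeSet Z b ω) j < M := hω.2
      refine Set.mem_inter (antitone_alive hij hω.1) (lt_of_le_of_lt ?_ hω2)
      exact Finset.sum_le_sum_of_subset (Finset.range_mono hij)
    have hlim := tendsto_measure_iInter_atTop (μ := μ)
      (fun d => (h.measurableSet_alive_inter_sum_lt hQP M d).nullMeasurableSet) hanti
      ⟨0, measure_ne_top _ _⟩
    rw [h.measure_iInter_alive_inter_sum_lt hQP (ENNReal.natCast_ne_top M)] at hlim
    have hlim' := hlim.const_add (Q {x | (M : ℝ≥0∞) < Q.rnDeriv P x})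
    rw [add_zero] at hlim'
    exact ge_of_tendsto' hlim' fun d =>
      (measure_mono (Set.iInter_subset _ d)).trans (h.measure_alive_le hQP d M)
  exact le_antisymm (ge_of_tendsto' (tendsto_measure_rnDeriv_gt hQP) h1) zero_le

theorem tendsto_measure_alive (hQP : Q ≪ P) :
    Tendsto (fun d => μ (alive Q P Z X U b d)) atTop (𝓝 0) := by
  rw [← h.measure_iInter_alive hQP]
  exact tendsto_measure_iInter_atTop
    (fun d => (h.le_space d _ (h.measurableSet_alive hQP d)).nullMeasurableSet) antitone_alive
    ⟨0, measure_ne_top _ _⟩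

/-- Since `τ_d ≤ Q` and the survival probability vanishes in the limit, the law is dominated by `Q`;
two probability measures so ordered coincide. -/
theorem hasLaw_returned (hQP : Q ≪ P) : HasLaw (returned Q P Z X U b) Q μ := by
  have hr := h.measurable_returned hQP
  refine ⟨hr.aemeasurable, ?_⟩
  have := Measure.isProbabilityMeasure_map (μ := μ) hr.aemeasurable
  refine Measure.eq_of_le_of_measure_univ_eq (Measure.le_iff.2 fun B hB => ?_) (by simp)
  have hlim := (h.tendsto_measure_alive hQP).const_add (Q B)
  rw [add_zero] at hlim
  rw [Measure.map_apply hr hB]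
  refine ge_of_tendsto' hlim fun d => (h.measure_returned_le hQP d hB).trans ?_
  exact add_le_add_left (h.τ_le hQP d hB) _

/-- As `τ_d ≤ Q`, only the deficit `Q - τ_d` counts, and it comes from runs still alive after `d`
steps. -/
theorem tvDist_le (hQP : Q ≪ P) (d : ℕ) :
    tvDist Q (τ μ Q P Z X U b d) ≤ μ (alive Q P Z X U b d) := by
  refine iSup₂_le fun s hs => max_le ?_ ?_
  · rw [tsub_le_iff_left]
    conv_lhs => rw [← (h.hasLaw_returned hQP).map_eq,
      Measure.map_apply (h.measurable_returned hQP) hs]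
    exact h.measure_returned_le hQP d hs
  · rw [tsub_eq_zero_of_le (h.τ_le hQP d hs)]
    exact zero_le

end IsRun

end Run

end GRC

/-- Correctness of greedy rejection coding. The proof covers every run: none of the three
alternatives in `hassump` is needed. -/
theorem theorem1 {Ω 𝓧 : Type*} [MeasurableSpace Ω] [MeasurableSpace 𝓧]
    (μ : Measure Ω) [IsProbabilityMeasure μ]
    (Q P : Measure 𝓧) [IsProbabilityMeasure Q] [IsProbabilityMeasure P] (hQP : Q ≪ P)
    (Z : ℕ → Ω → Set 𝓧) (X : ℕ → Ω → 𝓧) (U : ℕ → Ω → ℝ) (b : ℕ → Ω → Bool)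
    (ℋ 𝒢 : ℕ → MeasurableSpace Ω) (hrun : GRC.IsRun μ Q P Z X U b ℋ 𝒢)
    (hassump : GRC.FiniteRatioMode Q P ∨ GRC.SingleBranch μ Q P Z X U b ∨
      GRC.NicelyShrinking μ P Z) :
    (∀ᵐ ω ∂μ, ∃ d, GRC.Accepts Q P Z X U b d ω) ∧
      HasLaw (GRC.returned Q P Z X U b) Q μ ∧
      Tendsto (fun d => GRC.tvDist Q (GRC.τ μ Q P Z X U b d)) atTop (𝓝 0) := by
  refine ⟨?_, hrun.hasLaw_returned hQP, ?_⟩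
  · rw [ae_iff]
    refine measure_mono_null ?_ (hrun.measure_iInter_alive hQP)
    intro ω hω
    simp only [Set.mem_ofPred_eq, not_exists] at hω
    exact Set.mem_iInter.2 fun d j _ => hω j
  · exact tendsto_of_tendsto_of_tendsto_of_le_of_le tendsto_const_nhds
      (hrun.tendsto_measure_alive hQP) (fun _ => zero_le) (hrun.tvDist_le hQP)
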